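/- **Graphs.** Let $s\ge 0$. A graph with $s$ legs is a non-empty finite multigraph $G$ (loops and multiple edges allowed) with $s$ labelled legs attached to its vertices. It is *admissible* if it is connected, remains connected after removal of any one internal edge, and every vertex has valency at least $3$ (a loop counts twice, a leg once). Its loop number is $|E|-|V|+\#\{\text{components}\}$. A forest is a set of edges whose spanning subgraph has loop number $0$. **The moduli space $\mathcal{MRG}_{1,s}$ of holocolored graphs with remembered edges.** Consider triples $(G,\lambda,c)$ where $G$ is an admissible graph with $s$ legs, loop number $1$ and the maximal number $s$ of internal edges, $c:E(G)\to\{1,\dots,s\}$ is an injective (hence bijective) coloring, and $\lambda:E(G)\to\mathbb R_{\ge 0}$ has $\sum_e\lambda(e)=1$ and vanishes on a forest only. For $Z=\{\lambda=0\}$ let $G/Z$ be the graph obtained by collapsing the edges of $Z$; label every vertex of $G/Z$ by the set of colors of the edges of $Z$ collapsed to it. Two triples are identified if there is an isomorphism $G/Z\cong G'/Z'$ that preserves the labelled legs, the lengths and colors of the remaining edges, and the sets of remembered colors at the vertices. $\bar X_s=\mathcal{MRG}_{1,s}$ is the quotient of the disjoint union of the simplices $\{\lambda\}$ (one for each $(G,c)$)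 by this relation, with the quotient topology. Two points have the same *combinatorial type* if there is such an isomorphism with the condition on lengths omitted. **Statement.** The space $\bar X_s$ has a $\Delta$-complex structure whose open $m$-simplices are exactly the sets of all points of a given combinatorial type with $m+1$ remaining edges. Every such $\Delta$-complex structure is finite, and its Euler characteristic, i.e. the alternating sum of the ranks of the rational homology groups of its semi-simplicial chain complex, is $$\chi(\bar X_s)=(s!)^2\sum_{k=1}^{s}\frac{(-1)^{k-1}(1+\delta_{1,k})}{2k}\sum_{\substack{1\le i_1\le\cdots\le i_k\\ i_1+\cdots+i_k=s}}\frac{g(i_1,\dots,i_k)}{\prod_{n=1}^k i_n!\,(i_n-1)!},$$ where $$g(i_1,\dots,i_k)=\frac{k!}{\prod_{n\in\{i_1,\dots,i_k\}}\bigl|\{m\in\{1,\dots,k\}: i_m=n\}\bigr|!},$$ the product in the denominator being over the distinct values among $i_1,\dots,i_k$. -/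

import Mathlib

/-! ### Graphs with labelled legs -/

/-- A non-empty finite multigraph (loops and multiple edges allowed) with `s` labelled legs.
`E` is the set of internal edges, `ends e` the unordered pair of end points of `e`, and `leg i`
the vertex to which the `i`-th leg is attached. -/
structure LegGraph (s : ℕ) where
  V : Type
  E : Type
  [finV : Fintype V]
  [finE : Fintype E]
  [nonemptyV : Nonempty V]
  ends : E → Sym2 V
  leg : Fin s → V

attribute [instance] LegGraph.finV LegGraph.finE LegGraph.nonemptyV

namespace LegGraph

variable {s : ℕ}

/-- Two vertices are adjacent through an edge that belongs to `S`. -/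
def Adj (G : LegGraph s) (S : Set G.E) (u v : G.V) : Prop :=
  ∃ e ∈ S, G.ends e = s(u, v)

/-- The equivalence relation "lying in the same connected component of the spanning subgraph with
edge set `S`". -/
def compSetoid (G : LegGraph s) (S : Set G.E) : Setoid G.V :=
  Relation.EqvGen.setoid (G.Adj S)

/-- The connected components of the spanning subgraph with edge set `S`. -/
abbrev Comp (G : LegGraph s) (S : Set G.E) : Type :=
  Quotient (G.compSetoid S)

/-- The connected component that contains `v`. -/
def comp (G : LegGraph s) (S : Set G.E) (v : G.V) : G.Comp S :=
  Quotient.mk (G.compSetoid S) v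

/-- The spanning subgraph with edge set `S` is connected. -/
def ConnectedOn (G : LegGraph s) (S : Set G.E) : Prop :=
  ∀ u v : G.V, G.comp S u = G.comp S v

/-- The loop number (first Betti number) `|E| - |V| + (number of components)` of the spanning
subgraph with edge set `S`. -/
noncomputable def loopNumber (G : LegGraph s) (S : Set G.E) : ℤ :=
  (Nat.card S : ℤ) - Nat.card G.V + Nat.card (G.Comp S)

/-- The edge set `S` is a forest. -/
def IsForest (G : LegGraph s) (S : Set G.E) : Prop :=
  G.loopNumber S = 0

/-- The valency of a vertex: the number of half-edges at `v`, where a loop counts twice and a leg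
counts once. -/
noncomputable def valency (G : LegGraph s) (v : G.V) : ℕ :=
  Nat.card {e : G.E // v ∈ G.ends e} + Nat.card {e : G.E // G.ends e = s(v, v)} +
    Nat.card {i : Fin s // G.leg i = v}

/-- One-particle irreducible: connected, and still connected upon removal of any one edge. -/
def IsOnePI (G : LegGraph s) : Prop :=
  G.ConnectedOn Set.univ ∧ ∀ e : G.E, G.ConnectedOn {e}ᶜ

/-- Admissible: one-particle irreducible, and all vertices have valency at least three. -/
def Admissible (G : LegGraph s) : Prop :=
  G.IsOnePI ∧ ∀ v : G.V, 3 ≤ G.valency v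

/-- The graph `G / S`, in which all edges of `S` are collapsed: every connected component of
the spanning subgraph with edge set `S` becomes one vertex. -/
noncomputable def contract (G : LegGraph s) (S : Set G.E) : LegGraph s where
  V := G.Comp S
  E := {e : G.E // e ∉ S}
  finV := Fintype.ofFinite _
  finE := Fintype.ofFinite _
  nonemptyV := ⟨G.comp S (Classical.arbitrary G.V)⟩
  ends e := (G.ends e.1).map (G.comp S)
  leg i := G.comp S (G.leg i)

/-- Isomorphisms of graphs with legs; they preserve the label of each leg. -/
structure Iso (G G' : LegGraph s) where
  onV : G.V ≃ G'.V
  onE : G.E ≃ G'.E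
  ends_onE : ∀ e, G'.ends (onE e) = (G.ends e).map onV
  leg_onV : ∀ i, G'.leg i = onV (G.leg i)

namespace Iso

def refl (G : LegGraph s) : Iso G G where
  onV := Equiv.refl _
  onE := Equiv.refl _
  ends_onE e := by simp
  leg_onV i := rfl

def symm {G G' : LegGraph s} (φ : Iso G G') : Iso G' G where
  onV := φ.onV.symm
  onE := φ.onE.symm
  ends_onE e := by
    have h := φ.ends_onE (φ.onE.symm e)
    rw [Equiv.apply_symm_apply] at h
    rw [h, Sym2.map_map]
    simp
  leg_onV i := by rw [φ.leg_onV]; simp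

def trans {G G' G'' : LegGraph s} (φ : Iso G G') (ψ : Iso G' G'') : Iso G G'' where
  onV := φ.onV.trans ψ.onV
  onE := φ.onE.trans ψ.onE
  ends_onE e := by
    simp only [Equiv.trans_apply, ψ.ends_onE, φ.ends_onE, Sym2.map_map]
    rfl
  leg_onV i := by rw [ψ.leg_onV, φ.leg_onV]; rfl

end Iso

end LegGraph

/-! ### The moduli space of holocolored graphs with remembered edges -/

/-- An admissible graph of loop number `n` with `s` legs and with the maximal number
`s + 3 (n - 1)` of edges, whose edges are coloured injectively (hence bijectively) by the
`s + 3 (n - 1)` available colours (here `n ≥ 1`). -/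
structure HoloGraph (n s : ℕ) extends LegGraph s where
  admissible : toLegGraph.Admissible
  rank_eq : toLegGraph.loopNumber Set.univ = n
  color : E ≃ Fin (s + 3 * (n - 1))

/-- A metric of volume one on the graph `G`, edges of length zero being allowed, is regular if
it vanishes on a forest only. -/
def HoloGraph.Regular {n s : ℕ} (G : HoloGraph n s) (x : stdSimplex ℝ G.E) : Prop :=
  G.IsForest {e | x e = 0}

/-- The disjoint union of the simplices (without their faces at infinity) of regular metrics of
volume one, over all coloured graphs. It carries the topology of a disjoint union. -/
abbrev MetricHoloGraph (n s : ℕ) : Type 1 :=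
  Σ G : HoloGraph n s, {x : stdSimplex ℝ G.E // G.Regular x}

namespace MetricHoloGraph

variable {n s : ℕ}

/-- The length of an edge. -/
noncomputable def length (p : MetricHoloGraph n s) (e : p.1.E) : ℝ := p.2.1 e

/-- The set of edges of length zero. -/
def zeroEdges (p : MetricHoloGraph n s) : Set p.1.E := {e | p.length e = 0}

/-- The graph in which the edges of length zero have been collapsed. -/
noncomputable def collapse (p : MetricHoloGraph n s) : LegGraph s :=
  p.1.toLegGraph.contract p.zeroEdges

/-- The weight of a vertex of the collapsed graph: the set of the colours of all the edges that
were collapsed to this vertex. -/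
def weight (p : MetricHoloGraph n s) (v : p.collapse.V) : Set (Fin (s + 3 * (n - 1))) :=
  {c | ∃ e ∈ p.zeroEdges,
    (p.1.ends e).map (p.1.toLegGraph.comp p.zeroEdges) = s(v, v) ∧ p.1.color e = c}

/-- An isomorphism of collapsed graphs that respects the colours of the remaining edges and the
remembered colours at the vertices. -/
def IsColorIso (p q : MetricHoloGraph n s) (φ : p.collapse.Iso q.collapse) : Prop :=
  (∀ e, q.1.color (φ.onE e).1 = p.1.color e.1) ∧ ∀ v, q.weight (φ.onV v) = p.weight v

/-- `p` and `q` have the same combinatorial type: the same collapsed graph, the same colours and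
the same remembered colours. -/
def SameType (p q : MetricHoloGraph n s) : Prop :=
  ∃ φ : p.collapse.Iso q.collapse, IsColorIso p q φ

/-- Equivalence of coloured metric graphs with remembered edges: an isomorphism of the collapsed
graphs which respects legs, colours, remembered colours and lengths. -/
def Equivalent (p q : MetricHoloGraph n s) : Prop :=
  ∃ φ : p.collapse.Iso q.collapse,
    IsColorIso p q φ ∧ ∀ e, q.length (φ.onE e).1 = p.length e.1

theorem equivalent_equivalence : Equivalence (Equivalent (n := n) (s := s)) where
  refl p := ⟨LegGraph.Iso.refl _, ⟨fun _ => rfl, fun _ => rfl⟩, fun _ => rfl⟩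
  symm := by
    rintro p q ⟨φ, ⟨hc, hw⟩, hl⟩
    refine ⟨φ.symm, ⟨fun e => ?_, fun v => ?_⟩, fun e => ?_⟩
    · have := hc (φ.onE.symm e)
      rw [Equiv.apply_symm_apply] at this
      exact this.symm
    · have := hw (φ.onV.symm v)
      rw [Equiv.apply_symm_apply] at this
      exact this.symm
    · have := hl (φ.onE.symm e)
      rw [Equiv.apply_symm_apply] at this
      exact this.symm
  trans := by
    rintro p q r ⟨φ, ⟨hc, hw⟩, hl⟩ ⟨ψ, ⟨hc', hw'⟩, hl'⟩
    exact ⟨φ.trans ψ, ⟨fun e => (hc' _).trans (hc e), fun v => (hw' _).trans (hw v)⟩,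
      fun e => (hl' _).trans (hl e)⟩

instance setoid (n s : ℕ) : Setoid (MetricHoloGraph n s) :=
  ⟨Equivalent, equivalent_equivalence⟩

end MetricHoloGraph

/-- The moduli space of holocolored graphs with remembered edges, with the quotient topology. -/
def MRG (n s : ℕ) : Type 1 := Quotient (MetricHoloGraph.setoid n s)

namespace MRG

variable {n s : ℕ}

instance : TopologicalSpace (MRG n s) :=
  inferInstanceAs (TopologicalSpace (Quotient (MetricHoloGraph.setoid n s)))

/-- The point of the moduli space represented by a coloured metric graph. -/
def mk (p : MetricHoloGraph n s) : MRG n s := Quotient.mk (MetricHoloGraph.setoid n s) p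

end MRG

/-! ### Δ-complexes and their Euler characteristic -/

/-- The structure of a Δ-complex on a topological space `X`. -/
structure DeltaComplex.{u} (X : Type u) [TopologicalSpace X] where
  /-- the (index set of the) `n`-simplices -/
  simplex : ℕ → Type u
  /-- the characteristic map of an `n`-simplex -/
  map : ∀ {n : ℕ}, simplex n → C(stdSimplex ℝ (Fin (n + 1)), X)
  /-- the `i`-th face of an `(n+1)`-simplex, opposite to the `i`-th vertex -/
  face : ∀ {n : ℕ}, simplex (n + 1) → Fin (n + 2) → simplex n
  /-- the restriction of a characteristic map to a face is a characteristic map -/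
  map_face : ∀ {n : ℕ} (σ : simplex (n + 1)) (i : Fin (n + 2)) (t : stdSimplex ℝ (Fin (n + 1))),
    map (face σ i) t = map σ (stdSimplex.map i.succAbove t)
  /-- each point lies in the image of the interior of exactly one simplex, and characteristic
  maps are injective on interiors -/
  existsUnique_interior : ∀ x : X,
    ∃! a : Σ n : ℕ, simplex n × stdSimplex ℝ (Fin (n + 1)),
      (∀ j, 0 < a.2.2 j) ∧ map a.2.1 a.2.2 = x
  /-- `X` carries the weak topology -/
  isOpen_iff : ∀ A : Set X, IsOpen A ↔ ∀ (n : ℕ) (σ : simplex n), IsOpen (map σ ⁻¹' A)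

namespace DeltaComplex

variable {X : Type*} [TopologicalSpace X] (D : DeltaComplex X)

/-- There are only finitely many simplices. -/
def IsFinite : Prop := Finite (Σ n : ℕ, D.simplex n)

/-- The open simplex given by `σ`. -/
def openSimplex {n : ℕ} (σ : D.simplex n) : Set X :=
  D.map σ '' {t | ∀ j, 0 < t j}

/-- The boundary operator `C_{n+1} → C_n`, `σ ↦ ∑ i, (-1)^i d_i σ`, of the semi-simplicial chain
complex with rational coefficients. -/
noncomputable def boundary (n : ℕ) : (D.simplex (n + 1) →₀ ℚ) →ₗ[ℚ] (D.simplex n →₀ ℚ) :=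
  Finsupp.linearCombination ℚ fun σ : D.simplex (n + 1) =>
    ∑ i : Fin (n + 2), (-1 : ℚ) ^ (i : ℕ) • Finsupp.single (D.face σ i) (1 : ℚ)

/-- The cycles; all `0`-chains are cycles. -/
noncomputable def cycles : (n : ℕ) → Submodule ℚ (D.simplex n →₀ ℚ)
  | 0 => ⊤
  | n + 1 => LinearMap.ker (D.boundary n)

/-- The `n`-th rational homology of the semi-simplicial chain complex. -/
abbrev Homology (n : ℕ) : Type _ :=
  D.cycles n ⧸ (LinearMap.range (D.boundary n)).submoduleOf (D.cycles n)

/-- The Betti numbers. -/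
noncomputable def betti (n : ℕ) : ℕ := Module.finrank ℚ (D.Homology n)

/-- The Euler characteristic (meaningful for finite complexes): the alternating sum of the Betti
numbers. -/
noncomputable def eulerChar : ℤ := ∑ᶠ n : ℕ, (-1 : ℤ) ^ n * (D.betti n : ℤ)

/-- A Δ-complex structure on the moduli space is its decomposition by graphs if its open simplices
are the sets of all points of a given combinatorial type, a graph on which `m + 1` edges remain
giving an `m`-simplex. -/
def IsGraphDecomposition {n s : ℕ} (D : DeltaComplex (MRG n s)) : Prop :=
  (∀ p q : MetricHoloGraph n s,
    (∃ (m : ℕ) (σ : D.simplex m), MRG.mk p ∈ D.openSimplex σ ∧ MRG.mk q ∈ D.openSimplex σ) ↔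
      p.SameType q) ∧
  ∀ (p : MetricHoloGraph n s) (m : ℕ) (σ : D.simplex m), MRG.mk p ∈ D.openSimplex σ →
    Nat.card p.collapse.E = m + 1

end DeltaComplex

/-! ### The terms of the formula -/

open Classical in
/-- All sequences `1 ≤ i_1 ≤ … ≤ i_k` with sum `s`. -/
noncomputable def sortedTuples (s k : ℕ) : Finset (Fin k → ℕ) :=
  (Fintype.piFinset fun _ : Fin k => Finset.Icc 1 s).filter
    fun i => Monotone i ∧ ∑ n, i n = s

/-- `k!` divided by the product, over the different values `n` of the sequence `i`, of the
factorials of the multiplicities of `n`. -/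
def multiplicityFactor {k : ℕ} (i : Fin k → ℕ) : ℚ :=
  (k.factorial : ℚ) /
    ∏ n ∈ Finset.univ.image i, ((Finset.univ.filter fun m : Fin k => i m = n).card.factorial : ℚ)

/-! In loop number one, a one-particle irreducible graph has as many edges as vertices and is a
cycle (`IsOnePI.exists_cyclic_enumeration`). The cycle contributes two to each valency, so
admissibility puts exactly one leg at each of the `s` vertices (`HoloGraph.leg_bijective`). Every
proper set of edges is a forest, so no face of a simplex lies at infinity.

After collapsing, every vertex still carries a leg. The type of a point is therefore determined by
its remembered colours, by which legs share a vertex, and by which legs each colour joins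
(`exists_equiv_of_typeInv_eq`). Colours also name the edges, so a point is a type together with a
length function on colours (`equivalent_iff`), and a cell is a full simplex with vertices ordered by
colour. Since remembered edges keep their position, the type of a face depends only on the type of
the cell (`type_congr`). This gives the Δ-complex. In any other decomposition by graphs the
simplices again correspond to the types, so Euler-Poincaré reduces the claim to counting types.

A type with `k` remaining edges is a labelling of a `k`-cycle up to automorphism, in which each
vertex has one leg more than it has remembered colours, because collapsed components are trees. With
`n j` legs at vertex `j` there are `s!/∏ (n j)!` ways to place the legs and `s!/∏ (n j - 1)!` ways
to place the colours. The automorphisms act freely (`act_injective`); there are `2k` of them if `k ≥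
2` and one if `k = 1`, hence the factor `(1 + δ)/(2k)`. Sorting the sequence `n` produces the
multiplicity factor. -/

namespace LegGraph

/-! ### Components, forests, cycles and contraction. -/

variable {s : ℕ}

theorem comp_eq_of_mem {G : LegGraph s} {S : Set G.E} {e : G.E} (he : e ∈ S) {u v : G.V}
    (h : G.ends e = s(u, v)) : G.comp S u = G.comp S v :=
  Quotient.sound (Relation.EqvGen.rel _ _ ⟨e, he, h⟩)

/-- The component relation is generated by the edges of `S`. With a component map as `f`, this
transports connectivity to other edge sets and other graphs. -/
theorem comp_induction {G : LegGraph s} {S : Set G.E} {α : Sort*} (f : G.V → α)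
    (hf : ∀ e ∈ S, ∀ u v, G.ends e = s(u, v) → f u = f v) {u v : G.V}
    (h : G.comp S u = G.comp S v) : f u = f v := by
  have h' : Relation.EqvGen (G.Adj S) u v := Quotient.exact h
  clear h
  induction h' with
  | rel x y h =>
    obtain ⟨e, he, h⟩ := h
    exact hf e he x y h
  | refl x => rfl
  | symm x y hxy ih => exact ih.symm
  | trans x y z hxy hyz ih ih' => exact ih.trans ih'

/-- A function on the vertices that is constant along the edges of `S`, as a function on the
components. -/
def compLift {G : LegGraph s} (S : Set G.E) {α : Sort*} (f : G.V → α)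
    (hf : ∀ e ∈ S, ∀ u v, G.ends e = s(u, v) → f u = f v) : G.Comp S → α :=
  Quotient.lift f fun _ _ h => comp_induction f hf (Quotient.sound h)

@[simp]
theorem compLift_comp {G : LegGraph s} (S : Set G.E) {α : Sort*} (f : G.V → α)
    (hf : ∀ e ∈ S, ∀ u v, G.ends e = s(u, v) → f u = f v) (v : G.V) :
    compLift S f hf (G.comp S v) = f v := rfl

theorem comp_surjective (G : LegGraph s) (S : Set G.E) : Function.Surjective (G.comp S) :=
  Quotient.mk_surjective

theorem comp_mono {G : LegGraph s} {S T : Set G.E} (h : S ⊆ T) {u v : G.V}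
    (huv : G.comp S u = G.comp S v) : G.comp T u = G.comp T v :=
  comp_induction (G.comp T) (fun _ he _ _ h' => comp_eq_of_mem (h he) h') huv

theorem ConnectedOn.mono {G : LegGraph s} {S T : Set G.E} (h : S ⊆ T) (hS : G.ConnectedOn S) :
    G.ConnectedOn T := fun u v => comp_mono h (hS u v)

theorem ConnectedOn.card_comp {G : LegGraph s} {S : Set G.E} (h : G.ConnectedOn S) :
    Nat.card (G.Comp S) = 1 := by
  rw [Nat.card_eq_one_iff_unique]
  refine ⟨⟨fun x y => ?_⟩, ⟨G.comp S (Classical.arbitrary _)⟩⟩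
  obtain ⟨u, rfl⟩ := G.comp_surjective S x
  obtain ⟨v, rfl⟩ := G.comp_surjective S y
  exact h u v

theorem loopNumber_empty (G : LegGraph s) : G.loopNumber ∅ = 0 := by
  have : Nat.card G.V = Nat.card (G.Comp ∅) :=
    Nat.card_congr (Equiv.ofBijective (G.comp ∅)
      ⟨fun u v h => comp_induction id (fun _ he => he.elim) h, G.comp_surjective ∅⟩)
  rw [loopNumber, this]
  simp

/-- A new edge can only merge the two classes of its end points. -/
theorem card_comp_le_card_comp_insert (G : LegGraph s) (S : Set G.E) (e : G.E) :
    Nat.card (G.Comp S) ≤ Nat.card (G.Comp (insert e S)) + 1 := by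
  classical
  obtain ⟨a, b, hab⟩ : ∃ a b, G.ends e = s(a, b) := by
    induction h : G.ends e with | _ a b => exact ⟨a, b, rfl⟩
  let pr : G.Comp S → G.Comp (insert e S) :=
    compLift S (G.comp (insert e S)) fun e' he' u v h =>
      comp_eq_of_mem (Set.mem_insert_of_mem _ he') h
  have key : ∀ u v, G.comp (insert e S) u = G.comp (insert e S) v → G.comp S u ≠ G.comp S b →
      G.comp S v ≠ G.comp S b → G.comp S u = G.comp S v := by
    intro u v huv hu hv
    -- Redirecting the class of `b` to that of `a` gives a function that is constant along the new
    -- edge too.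
    have := comp_induction
      (fun u => if G.comp S u = G.comp S b then G.comp S a else G.comp S u) (fun e' he' x y h => by
        rcases he' with rfl | he'
        · have : s(x, y) = s(a, b) := h.symm.trans hab
          rcases Sym2.eq_iff.1 this with ⟨rfl, rfl⟩ | ⟨rfl, rfl⟩ <;> simp +contextual
        · simp only [comp_eq_of_mem he' h]) huv
    simpa [hu, hv] using this
  rw [← Finite.card_option]
  refine Nat.card_le_card_of_injective
    (fun x : G.Comp S => if x = G.comp S b then none else some (pr x)) fun x y hxy => ?_
  obtain ⟨u, rfl⟩ := G.comp_surjective S x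
  obtain ⟨v, rfl⟩ := G.comp_surjective S y
  by_cases hu : G.comp S u = G.comp S b <;> by_cases hv : G.comp S v = G.comp S b
  · rw [hu, hv]
  · simp [hu, hv] at hxy
  · simp [hu, hv] at hxy
  · simp only [hu, hv, if_false, Option.some.injEq] at hxy
    exact key u v hxy hu hv

/-- A new edge raises the edge count by one and lowers the number of components by at most one. -/
theorem loopNumber_le_insert (G : LegGraph s) (S : Set G.E) (e : G.E) :
    G.loopNumber S ≤ G.loopNumber (insert e S) := by
  by_cases he : e ∈ S
  · rw [Set.insert_eq_of_mem he]
  · have h1 := G.card_comp_le_card_comp_insert S e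
    have h2 : Nat.card (insert e S : Set G.E) = Nat.card S + 1 := by
      simp only [Nat.card_coe_set_eq]
      exact Set.ncard_insert_of_notMem he
    unfold loopNumber
    omega

theorem loopNumber_mono (G : LegGraph s) {S T : Set G.E} (h : S ⊆ T) :
    G.loopNumber S ≤ G.loopNumber T := by
  have key : ∀ U : Set G.E, G.loopNumber S ≤ G.loopNumber (U ∪ S) := by
    intro U
    induction U, Set.toFinite U using Set.Finite.induction_on with
    | empty => simp
    | insert _ _ ih =>
      rw [Set.insert_union]
      exact ih.trans (G.loopNumber_le_insert _ _)
  simpa [Set.union_eq_self_of_subset_right h] using key T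

theorem loopNumber_nonneg (G : LegGraph s) (S : Set G.E) : 0 ≤ G.loopNumber S :=
  G.loopNumber_empty ▸ G.loopNumber_mono (Set.empty_subset S)

theorem IsForest.mono {G : LegGraph s} {S T : Set G.E} (h : S ⊆ T) (hT : G.IsForest T) :
    G.IsForest S :=
  le_antisymm ((G.loopNumber_mono h).trans hT.le) (G.loopNumber_nonneg S)

theorem IsOnePI.isForest_compl_singleton {G : LegGraph s} (h : G.IsOnePI)
    (hc : Nat.card G.E = Nat.card G.V) (e : G.E) : G.IsForest {e}ᶜ := by
  have h1 := (h.2 e).card_comp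
  have h2 : Nat.card ({e}ᶜ : Set G.E) + 1 = Nat.card G.E := by
    have := Set.ncard_add_ncard_compl ({e} : Set G.E)
    rw [Set.ncard_singleton] at this
    rw [Nat.card_coe_set_eq]; omega
  unfold IsForest loopNumber
  omega

/-- Deleting one edge leaves a connected graph of loop number zero, and subsets of forests are
forests. Consequently every metric of volume one is regular in loop number one. -/
theorem IsOnePI.isForest {G : LegGraph s} (h : G.IsOnePI)
    (hc : Nat.card G.E = Nat.card G.V) {S : Set G.E} (hS : S ≠ Set.univ) : G.IsForest S := by
  obtain ⟨e, he⟩ := (Set.ne_univ_iff_exists_notMem S).1 hS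
  exact (h.isForest_compl_singleton hc e).mono (by simpa using he)

/-- In a forest, each component has one vertex more than it has edges. -/
theorem IsForest.card_component {G : LegGraph s} {S : Set G.E} (h : G.IsForest S)
    (w : G.Comp S) :
    Nat.card {e : G.E // e ∈ S ∧ (G.ends e).map (G.comp S) = s(w, w)} + 1 =
      Nat.card {v : G.V // G.comp S v = w} := by
  classical
  set T : Set G.E := {e | e ∈ S ∧ (G.ends e).map (G.comp S) = s(w, w)} with hT
  have hTS : T ⊆ S := fun e he => he.1
  have hf : G.loopNumber T = 0 := h.mono hTS
  have key : ∀ u v, Relation.EqvGen (G.Adj S) u v → G.comp S u = w → G.comp T u = G.comp T v := by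
    intro u v huv
    induction huv with
    | rel x y hxy =>
      obtain ⟨e, he, hxy⟩ := hxy
      intro hx
      refine comp_eq_of_mem (S := T) (e := e) ⟨he, ?_⟩ hxy
      rw [hxy, Sym2.map_mk, ← comp_eq_of_mem he hxy, hx]
    | refl x => intro _; rfl
    | symm x y hxy ih =>
      intro hy
      exact (ih ((show G.comp S x = G.comp S y from Quotient.sound hxy).trans hy)).symm
    | trans x y z hxy hyz ih ih' =>
      intro hx
      exact (ih hx).trans (ih' ((show G.comp S x = G.comp S y from Quotient.sound hxy) ▸ hx))
  -- The components of `T` are `w` itself and the single vertices outside `w`; `f` records this, and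
  -- `loopNumber T = 0` then becomes the desired count.
  let f : G.V → Option {v : G.V // G.comp S v ≠ w} := fun u =>
    if hu : G.comp S u = w then none else some ⟨u, hu⟩
  have hfT : ∀ e ∈ T, ∀ u v, G.ends e = s(u, v) → f u = f v := by
    intro e he u v huv
    have := he.2
    rw [huv, Sym2.map_mk] at this
    have hw : G.comp S u = w ∧ G.comp S v = w := by
      rcases Sym2.eq_iff.1 this with h | h <;> exact h
    simp [f, hw.1, hw.2]
  have hbij : Function.Bijective (compLift T f hfT) := by
    constructor
    · intro x y hxy
      obtain ⟨u, rfl⟩ := G.comp_surjective T x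
      obtain ⟨v, rfl⟩ := G.comp_surjective T y
      simp only [compLift_comp, f] at hxy
      by_cases hu : G.comp S u = w <;> by_cases hv : G.comp S v = w
      · exact key u v (Quotient.exact (hu.trans hv.symm)) hu
      · simp [hu, hv] at hxy
      · simp [hu, hv] at hxy
      · simp only [hu, hv, dite_false, Option.some.injEq, Subtype.mk.injEq] at hxy
        rw [hxy]
    · rintro (_ | ⟨v, hv⟩)
      · obtain ⟨u, rfl⟩ := G.comp_surjective S w
        exact ⟨G.comp T u, by simp [f]⟩
      · exact ⟨G.comp T v, by simp [f, hv]⟩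
  have h1 : Nat.card (G.Comp T) = Nat.card {v : G.V // G.comp S v ≠ w} + 1 := by
    rw [Nat.card_congr (Equiv.ofBijective _ hbij), Finite.card_option]
  have h2 : Nat.card {v : G.V // G.comp S v = w} + Nat.card {v : G.V // G.comp S v ≠ w} =
      Nat.card G.V := by
    rw [← Nat.card_sum, Nat.card_congr (Equiv.sumCompl _)]
  change Nat.card T + 1 = _
  unfold loopNumber at hf
  omega

/-- A one-particle irreducible graph with as many edges as vertices is a cycle. -/
theorem IsOnePI.exists_cyclic_enumeration {G : LegGraph s} (h : G.IsOnePI) {m : ℕ}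
    (hE : Nat.card G.E = m + 1) (hV : Nat.card G.V = m + 1) :
    ∃ (v : ZMod (m + 1) ≃ G.V) (e : ZMod (m + 1) ≃ G.E),
      ∀ i, G.ends (e i) = s(v i, v (i + 1)) := by
  classical
  have : Nonempty G.E := (Nat.card_pos_iff.1 (by omega)).1
  let e₀ : G.E := Classical.arbitrary _
  obtain ⟨a, b, hab⟩ : ∃ a b, G.ends e₀ = s(a, b) := by
    induction h : G.ends e₀ with | _ a b => exact ⟨a, b, rfl⟩
  -- Without `e₀` the graph is still connected; a simple path from `b` to `a`, closed up by `e₀`,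
  -- will turn out to be the whole graph.
  let A : SimpleGraph G.V := SimpleGraph.fromRel (G.Adj {e₀}ᶜ)
  have hreach : A.Reachable b a := by
    have := h.2 e₀ b a
    have h' : A.connectedComponentMk b = A.connectedComponentMk a := by
      refine comp_induction A.connectedComponentMk (fun e he u v huv => ?_) this
      by_cases huv' : u = v
      · rw [huv']
      · exact SimpleGraph.ConnectedComponent.sound
          (SimpleGraph.Adj.reachable ⟨huv', Or.inl ⟨e, he, huv⟩⟩)
    exact SimpleGraph.ConnectedComponent.exact h'
  obtain ⟨p, hp⟩ := hreach.exists_isPath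
  set l := p.length with hl
  have hstep : ∀ i : ℕ, i < l → ∃ e, e ≠ e₀ ∧ G.ends e = s(p.getVert i, p.getVert (i + 1)) := by
    intro i hi
    obtain ⟨-, ⟨e, he, h⟩ | ⟨e, he, h⟩⟩ := p.adj_getVert_succ hi
    · exact ⟨e, he, h⟩
    · exact ⟨e, he, h.trans Sym2.eq_swap⟩
  have hinj := hp.getVert_injOn
  choose! g hg hg' using hstep
  let v : Fin (l + 1) → G.V := fun i => p.getVert i
  let e : Fin (l + 1) → G.E := fun i => if (i : ℕ) < l then g i else e₀
  have hv : Function.Injective v := fun i j hij =>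
    Fin.ext (hinj (Nat.lt_succ_iff.1 i.2) (Nat.lt_succ_iff.1 j.2) hij)
  have hends : ∀ i, G.ends (e i) = s(v i, v (i + 1)) := by
    intro i
    simp only [e, v]
    split_ifs with hi
    · rw [hg' i hi, Fin.val_add_one_of_lt (by rw [Fin.lt_def]; simpa using hi)]
    · have : i = Fin.last l := Fin.ext (by have := i.2; simp; omega)
      subst this
      simp only [Fin.last_add_one, Fin.val_last, Fin.val_zero, SimpleGraph.Walk.getVert_zero, hab]
      rw [hl, SimpleGraph.Walk.getVert_length]
  have he : Function.Injective e := by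
    intro i j hij
    simp only [e] at hij
    split_ifs at hij with hi hj hj
    · have := (hg' i hi).symm.trans ((congrArg G.ends hij).trans (hg' j hj))
      rcases Sym2.eq_iff.1 this with ⟨h1, -⟩ | ⟨h1, h2⟩
      · exact Fin.ext (hinj hi.le hj.le h1)
      · have h1' := hinj (x₁ := (i : ℕ)) (x₂ := (j : ℕ) + 1) hi.le (Nat.succ_le_of_lt hj) h1
        have h2' := hinj (x₁ := (i : ℕ) + 1) (x₂ := (j : ℕ)) (Nat.succ_le_of_lt hi) hj.le h2
        omega
    · exact absurd hij (hg i hi)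
    · exact absurd hij.symm (hg j hj)
    · exact Fin.ext (by omega)
  -- If an edge were missed, the closed path would be a forest. But dropping `e₀` from it leaves the
  -- components unchanged, which would make the loop number negative.
  have hsurj : Function.Surjective e := by
    by_contra hns
    obtain ⟨x, hx⟩ : ∃ x, x ∉ Set.range e := by simpa [Function.Surjective] using hns
    have hf : G.IsForest (Set.range e) := (h.isForest_compl_singleton (hE.trans hV.symm) x).mono
      (by rintro _ ⟨i, rfl⟩; rintro rfl; exact hx ⟨i, rfl⟩)
    set S := Set.range e
    have he₀ : e₀ ∈ S := ⟨Fin.last l, by simp [e]⟩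
    have hpath : ∀ i ≤ l, G.comp (S \ {e₀}) b = G.comp (S \ {e₀}) (p.getVert i) := by
      intro i
      induction i with
      | zero => simp
      | succ i ih =>
        intro hi
        refine (ih (by omega)).trans (comp_eq_of_mem (S := S \ {e₀}) (e := g i)
          ⟨⟨⟨i, by omega⟩, ?_⟩, ?_⟩ (hg' i hi))
        · simp [e, Nat.lt_of_succ_le hi]
        · exact hg i hi
    have hba : G.comp (S \ {e₀}) b = G.comp (S \ {e₀}) a := by
      have := hpath l le_rfl
      rwa [hl, SimpleGraph.Walk.getVert_length] at this
    have hcomp : Nat.card (G.Comp (S \ {e₀})) = Nat.card (G.Comp S) := by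
      refine Nat.card_congr (Equiv.ofBijective (compLift (S \ {e₀}) (G.comp S)
        fun e' he' u v h => comp_eq_of_mem he'.1 h) ⟨fun x y hxy => ?_, fun x => ?_⟩)
      · obtain ⟨u, rfl⟩ := G.comp_surjective _ x
        obtain ⟨v, rfl⟩ := G.comp_surjective _ y
        refine comp_induction _ (fun e' he' x y hxy => ?_) hxy
        by_cases h' : e' = e₀
        · subst h'
          rcases Sym2.eq_iff.1 (hxy.symm.trans hab) with ⟨rfl, rfl⟩ | ⟨rfl, rfl⟩
          · exact hba.symm
          · exact hba
        · exact comp_eq_of_mem (S := S \ {e₀}) ⟨he', h'⟩ hxy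
      · obtain ⟨u, rfl⟩ := G.comp_surjective _ x
        exact ⟨G.comp _ u, rfl⟩
    have hcard : Nat.card (S \ {e₀} : Set G.E) + 1 = Nat.card S := by
      simp only [Nat.card_coe_set_eq]
      exact Set.ncard_sdiff_singleton_add_one he₀
    have h0 := G.loopNumber_nonneg (S \ {e₀})
    unfold IsForest at hf
    unfold loopNumber at hf h0
    omega
  have hlm : l = m := by
    have := Nat.card_congr (Equiv.ofBijective e ⟨he, hsurj⟩)
    rw [hE, Nat.card_eq_fintype_card, Fintype.card_fin] at this
    omega
  clear_value l
  subst hlm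
  have hvb : Function.Bijective v := by
    rw [Fintype.bijective_iff_injective_and_card]
    exact ⟨hv, by rw [← Nat.card_eq_fintype_card, ← Nat.card_eq_fintype_card, hV]; simp⟩
  -- `ZMod (l + 1)` is `Fin (l + 1)` by definition, with the same wrap-around addition.
  exact ⟨Equiv.ofBijective v hvb, Equiv.ofBijective e ⟨he, hsurj⟩, hends⟩

/-- Connected spanning subgraphs have connected images, and deleting an edge of `G / S` leaves the
image of `G` with that edge deleted. -/
theorem contract_isOnePI {G : LegGraph s} (h : G.IsOnePI) (S : Set G.E) :
    (G.contract S).IsOnePI := by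
  have key : ∀ T : Set G.E, G.ConnectedOn T →
      (G.contract S).ConnectedOn {e : (G.contract S).E | e.1 ∈ T} := by
    intro T hT x y
    obtain ⟨u, rfl⟩ := G.comp_surjective S x
    obtain ⟨v, rfl⟩ := G.comp_surjective S y
    refine comp_induction (fun u => (G.contract S).comp _ (G.comp S u))
      (fun e he u v huv => ?_) (hT u v)
    by_cases heS : e ∈ S
    · exact congrArg _ (comp_eq_of_mem heS huv)
    · refine comp_eq_of_mem (G := G.contract S) (e := ⟨e, heS⟩) he ?_
      change (G.ends e).map (G.comp S) = _
      rw [huv, Sym2.map_mk]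
      rfl
  refine ⟨(key _ h.1).mono (Set.subset_univ _), fun e => (key _ (h.2 e.1)).mono ?_⟩
  rintro e' he' rfl
  exact he' rfl

/-- Collapsing a forest removes as many vertices as edges, so the quotient is again a cycle. -/
theorem IsForest.card_comp {G : LegGraph s} {S : Set G.E} (h : G.IsForest S)
    (hc : Nat.card G.E = Nat.card G.V) :
    Nat.card (G.Comp S) = Nat.card {e : G.E // e ∉ S} := by
  classical
  have h2 : Nat.card S + Nat.card {e : G.E // e ∉ S} = Nat.card G.E := by
    rw [← Nat.card_congr (Equiv.sumCompl (fun e => e ∈ S)), Nat.card_sum]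
  unfold IsForest loopNumber at h
  omega

end LegGraph


/-! ### The combinatorial type as an invariant -/

/-- The values of `typeInv`. -/
abbrev TypeInv (s : ℕ) : Type :=
  Set (Fin s) × Set (Fin s × Fin s) × (Fin s → Set (Fin s × Fin s))

/-- The isomorphism invariant of a graph with vertex set `Q`, legs attached by `L`, and edges
with colours and end points `E`, the edges with colour in `Z` being remembered only. -/
def typeInv {s : ℕ} {Q : Type*} (Z : Set (Fin s)) (L : Fin s → Q) (E : Fin s → Sym2 Q) :
    TypeInv s :=
  (Z, {x | L x.1 = L x.2}, fun c => {x | E c = s(L x.1, L x.2)})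

section typeInv

variable {s : ℕ} {Q Q' : Type*} {Z Z' : Set (Fin s)} {L : Fin s → Q} {L' : Fin s → Q'}
  {E : Fin s → Sym2 Q} {E' : Fin s → Sym2 Q'}

/-- The invariant only records coincidences between positions, which any injection preserves and
reflects. -/
theorem typeInv_congr {h : Q → Q'} (hh : Function.Injective h) (hZ : Z = Z')
    (hL : ∀ i, L' i = h (L i)) (hE : ∀ c, E' c = (E c).map h) :
    typeInv Z L E = typeInv Z' L' E' := by
  subst hZ
  refine Prod.ext rfl (Prod.ext ?_ ?_)
  · ext x
    simp only [typeInv, Set.mem_ofPred_eq, hL]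
    exact hh.eq_iff.symm
  · funext c
    ext x
    simp only [typeInv, Set.mem_ofPred_eq, hL, hE]
    rw [← (Sym2.map.injective hh).eq_iff, Sym2.map_mk]

/-- Completeness of the invariant: each vertex is named by any leg attached to it, and `ψ` matches
vertices with the same names. -/
theorem exists_equiv_of_typeInv_eq (hL : Function.Surjective L) (hL' : Function.Surjective L')
    (h : typeInv Z L E = typeInv Z' L' E') :
    Z = Z' ∧ ∃ ψ : Q ≃ Q', (∀ i, L' i = ψ (L i)) ∧ ∀ c, E' c = (E c).map ψ := by
  have h1 : Z = Z' := congrArg Prod.fst h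
  have h2 : ∀ i j, L i = L j ↔ L' i = L' j := fun i j =>
    Set.ext_iff.1 (congrArg (fun x => x.2.1) h) (i, j)
  have h3 : ∀ c i j, E c = s(L i, L j) ↔ E' c = s(L' i, L' j) := fun c i j =>
    Set.ext_iff.1 (congrFun (congrArg (fun x => x.2.2) h) c) (i, j)
  choose g hg using hL
  have hψ : ∀ i, L' (g (L i)) = L' i := fun i => (h2 _ _).1 (hg _)
  have hb : Function.Bijective fun q => L' (g q) := by
    constructor
    · intro q q' hqq
      rw [← hg q, ← hg q']
      exact (h2 _ _).2 hqq
    · intro q'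
      obtain ⟨i, rfl⟩ := hL' q'
      exact ⟨L i, hψ i⟩
  refine ⟨h1, Equiv.ofBijective _ hb, fun i => (hψ i).symm, fun c => ?_⟩
  induction hc : E c with | _ x y =>
  rw [Sym2.map_mk]
  exact (h3 c _ _).1 (by rw [hc, hg, hg])

end typeInv

/-! ### Coloured graphs of loop number one. -/

namespace HoloGraph

variable {s : ℕ}

/-- The colours, as elements of `Fin s`. -/
def col (G : HoloGraph 1 s) : G.E ≃ Fin s := G.color

/-- The combinatorial type of the graph in which the edges in `S` have been collapsed. -/
noncomputable def type (G : HoloGraph 1 s) (S : Set G.E) : TypeInv s :=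
  typeInv {c | G.col.symm c ∈ S} (fun i => G.comp S (G.leg i))
    (fun c => (G.ends (G.col.symm c)).map (G.comp S))

theorem card_E (G : HoloGraph 1 s) : Nat.card G.E = s := by
  rw [Nat.card_congr G.col]; simp

theorem card_V (G : HoloGraph 1 s) : Nat.card G.V = s := by
  have h := G.rank_eq
  have h1 := G.admissible.1.1.card_comp
  have h2 := G.card_E
  unfold LegGraph.loopNumber at h
  rw [h1] at h
  have h3 : Nat.card (Set.univ : Set G.E) = s := by
    exact (Nat.card_congr (Equiv.Set.univ _)).trans h2
  rw [h3] at h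
  push_cast at h
  omega

theorem card_E_eq_card_V (G : HoloGraph 1 s) : Nat.card G.E = Nat.card G.V :=
  G.card_E.trans G.card_V.symm

/-- On a cycle the edges contribute only two to a valency, so each vertex needs a leg; there are `s`
legs and `s` vertices. -/
theorem leg_bijective (G : HoloGraph 1 s) : Function.Bijective G.leg := by
  classical
  suffices h : Function.Surjective G.leg by
    rw [Fintype.bijective_iff_surjective_and_card]
    exact ⟨h, by rw [← Nat.card_eq_fintype_card, ← Nat.card_eq_fintype_card, G.card_V]; simp⟩
  have hs : s ≠ 0 := by
    have := G.card_V
    have h2 : 0 < Nat.card G.V := Nat.card_pos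
    omega
  obtain ⟨m, rfl⟩ := Nat.exists_eq_succ_of_ne_zero hs
  obtain ⟨v, e, hve⟩ := G.admissible.1.exists_cyclic_enumeration G.card_E G.card_V
  intro x
  by_contra hx
  obtain ⟨i, rfl⟩ := v.surjective x
  have hval := G.admissible.2 (v i)
  have h3 : Nat.card {j // G.leg j = v i} = 0 := by
    rw [Finite.card_eq_zero_iff]
    exact ⟨fun j => hx ⟨j.1, j.2⟩⟩
  have h1 : Nat.card {x : G.E // v i ∈ G.ends x} =
      (Set.ncard ({e i, e (i - 1)} : Set G.E)) := by
    rw [← Nat.card_coe_set_eq]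
    refine Nat.card_congr (Equiv.setCongr (s := {x : G.E | v i ∈ G.ends x}) ?_)
    ext x
    obtain ⟨j, rfl⟩ := e.surjective x
    simp only [Set.mem_ofPred_eq, hve, Sym2.mem_iff, Set.mem_insert_iff, Set.mem_singleton_iff,
      EmbeddingLike.apply_eq_iff_eq]
    rw [eq_comm, eq_sub_iff_add_eq, @eq_comm _ i (j + 1)]
  -- A loop exists only on the one-vertex cycle, where `e i` and `e (i - 1)` coincide; so the total
  -- is two in both cases.
  have h2 : {x : G.E | G.ends x = s(v i, v i)} ⊆ {x | x = e i ∧ (1 : ZMod (m + 1)) = 0} := by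
    intro x hx
    obtain ⟨j, rfl⟩ := e.surjective x
    simp only [Set.mem_ofPred_eq, hve] at hx
    have : v j = v i ∧ v (j + 1) = v i := by
      rcases Sym2.eq_iff.1 hx with h | h <;> exact h
    have h1 := v.injective this.1
    have h2 := v.injective this.2
    subst h1
    exact ⟨rfl, by simpa using h2⟩
  have h2' := Set.ncard_le_ncard h2 (Set.toFinite _)
  rw [← Nat.card_coe_set_eq] at h2'
  unfold LegGraph.valency at hval
  change Nat.card {x : G.E // G.ends x = s(v i, v i)} ≤ _ at h2'
  by_cases h10 : (1 : ZMod (m + 1)) = 0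
  · have : i - 1 = i := by rw [h10, sub_zero]
    rw [this, Set.pair_eq_singleton, Set.ncard_singleton] at h1
    have : {x | x = e i ∧ (1 : ZMod (m + 1)) = 0} = {e i} := by ext; simp [h10]
    rw [this, Set.ncard_singleton] at h2'
    omega
  · have : {x | x = e i ∧ (1 : ZMod (m + 1)) = 0} = ∅ := by ext; simp [h10]
    rw [this, Set.ncard_empty] at h2'
    have := Set.ncard_insert_le (e i) {e (i - 1)}
    rw [Set.ncard_singleton] at this
    omega

theorem comp_leg_surjective (G : HoloGraph 1 s) (S : Set G.E) :
    Function.Surjective fun i => G.comp S (G.leg i) :=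
  (G.comp_surjective S).comp G.leg_bijective.2

/-- The combinatorial type after collapsing more edges depends only on the combinatorial type. -/
theorem type_congr {G G' : HoloGraph 1 s} {S T : Set G.E} {S' T' : Set G'.E}
    (hST : S ⊆ T) (hST' : S' ⊆ T') (hT : ∀ c, G.col.symm c ∈ T ↔ G'.col.symm c ∈ T')
    (h : G.type S = G'.type S') : G.type T = G'.type T' := by
  -- `ψ` descends to the further quotients because an edge of `T` and the edge of the same colour in
  -- `T'` have matching end points. Used for `ψ` and for its inverse, this gives mutually inverse
  -- maps.
  have aux : ∀ {G G' : HoloGraph 1 s} {S T : Set G.E} {S' T' : Set G'.E}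
      (_ : S ⊆ T) (_ : S' ⊆ T') (_ : ∀ c, G.col.symm c ∈ T ↔ G'.col.symm c ∈ T')
      (ψ : G.Comp S ≃ G'.Comp S')
      (_ : ∀ c, (G'.ends (G'.col.symm c)).map (G'.comp S') =
        ((G.ends (G.col.symm c)).map (G.comp S)).map ψ),
      ∃ h : G.Comp T → G'.Comp T', ∀ u u', G'.comp S' u' = ψ (G.comp S u) →
        h (G.comp T u) = G'.comp T' u' := by
    intro G G' S T S' T' hST hST' hT ψ hψ
    let pr : G'.Comp S' → G'.Comp T' :=
      LegGraph.compLift S' (G'.comp T') fun e he u v h => LegGraph.comp_eq_of_mem (hST' he) h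
    refine ⟨LegGraph.compLift T (fun u => pr (ψ (G.comp S u))) fun e he u v huv => ?_,
      fun u u' huu => ?_⟩
    · have h1 := hψ (G.col e)
      rw [Equiv.symm_apply_apply, huv, Sym2.map_mk, Sym2.map_mk] at h1
      have h2 : G'.col.symm (G.col e) ∈ T' := (hT _).1 (by simpa using he)
      induction h3 : G'.ends (G'.col.symm (G.col e)) with | _ x y =>
      have h4 := LegGraph.comp_eq_of_mem h2 h3
      rw [h3, Sym2.map_mk] at h1
      rcases Sym2.eq_iff.1 h1 with ⟨h5, h6⟩ | ⟨h5, h6⟩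
      · simp only [← h5, ← h6]; exact h4
      · simp only [← h5, ← h6]; exact h4.symm
    · simp only [LegGraph.compLift_comp, ← huu]
      rfl
  obtain ⟨-, ψ, hψL, hψE⟩ := exists_equiv_of_typeInv_eq (G.comp_leg_surjective S)
    (G'.comp_leg_surjective S') h
  obtain ⟨h, hh⟩ := aux hST hST' hT ψ hψE
  obtain ⟨h', hh'⟩ := aux (T := T') (T' := T) hST' hST (fun c => (hT c).symm) ψ.symm fun c => by
    rw [hψE, Sym2.map_map, Equiv.symm_comp_self, Sym2.map_id, id]
  refine typeInv_congr (h := h) (Function.LeftInverse.injective (g := h') fun x => ?_)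
    (Set.ext hT) (fun i => (hh _ _ (hψL i)).symm) fun c => ?_
  · obtain ⟨u, rfl⟩ := G.comp_surjective T x
    obtain ⟨u', hu'⟩ := G'.comp_surjective S' (ψ (G.comp S u))
    rw [hh u u' hu', hh' u' u (by rw [hu', Equiv.symm_apply_apply])]
  · have h1 := hψE c
    induction h2 : G.ends (G.col.symm c) with | _ x y =>
    induction h3 : G'.ends (G'.col.symm c) with | _ x' y' =>
    simp only [h2, h3, Sym2.map_mk] at h1 ⊢
    rcases Sym2.eq_iff.1 h1 with ⟨h5, h6⟩ | ⟨h5, h6⟩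
    · rw [hh _ _ h5, hh _ _ h6]
    · rw [hh _ _ h5, hh _ _ h6, Sym2.eq_swap]

end HoloGraph

/-! ### Equivalence of points in terms of types and lengths. -/

namespace MetricHoloGraph

variable {s : ℕ}

/-- The combinatorial type of a point. -/
noncomputable def type (p : MetricHoloGraph 1 s) : TypeInv s := p.1.type p.zeroEdges

theorem IsColorIso.mem_zeroEdges {p q : MetricHoloGraph 1 s} {φ : p.collapse.Iso q.collapse}
    (h : IsColorIso p q φ) (c : Fin s) :
    p.1.col.symm c ∈ p.zeroEdges ↔ q.1.col.symm c ∈ q.zeroEdges := by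
  have key : ∀ {p q : MetricHoloGraph 1 s} {φ : p.collapse.Iso q.collapse}
      (_ : ∀ e, q.1.color (φ.onE e).1 = p.1.color e.1) (c : Fin s),
      p.1.col.symm c ∉ p.zeroEdges → q.1.col.symm c ∉ q.zeroEdges := by
    intro p q φ h c hc
    have h1 : q.1.col (φ.onE ⟨_, hc⟩).1 = c := (h ⟨_, hc⟩).trans (p.1.col.apply_symm_apply c)
    rw [← h1, Equiv.symm_apply_apply]
    exact (φ.onE ⟨_, hc⟩).2
  refine not_iff_not.1 ⟨key h.1 c, key (φ := φ.symm) (fun e => ?_) c⟩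
  have := h.1 (φ.onE.symm e)
  rw [Equiv.apply_symm_apply] at this
  exact this.symm

theorem IsColorIso.type_eq {p q : MetricHoloGraph 1 s} {φ : p.collapse.Iso q.collapse}
    (h : IsColorIso p q φ) : p.type = q.type := by
  refine typeInv_congr (h := φ.onV) φ.onV.injective (Set.ext h.mem_zeroEdges) φ.leg_onV fun c => ?_
  by_cases hc : p.1.col.symm c ∈ p.zeroEdges
  -- The position of a collapsed edge is read off from the vertex weight containing its colour.
  · induction h2 : p.1.ends (p.1.col.symm c) with | _ x y =>
    have hxy := LegGraph.comp_eq_of_mem hc h2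
    obtain ⟨w, hw⟩ : ∃ w : p.collapse.V, w = p.1.comp p.zeroEdges x := ⟨_, rfl⟩
    have hcw : c ∈ p.weight w :=
      ⟨_, hc, by rw [h2, Sym2.map_mk, ← hxy, hw]; rfl, p.1.col.apply_symm_apply c⟩
    rw [← h.2] at hcw
    obtain ⟨e, he, he', hec⟩ := hcw
    have : q.1.col.symm c = e := by
      rw [Equiv.symm_apply_eq]; exact hec.symm
    rw [this, Sym2.map_mk, ← hxy, ← hw]
    exact he'
  · have h1 : q.1.col (φ.onE ⟨_, hc⟩).1 = c :=
      (h.1 ⟨_, hc⟩).trans (p.1.col.apply_symm_apply c)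
    have h2 := φ.ends_onE ⟨_, hc⟩
    rw [← Equiv.eq_symm_apply] at h1
    rw [← h1]
    exact h2

/-- Edges are matched by colour. The last clause makes this explicit, so that lengths can be
compared. -/
theorem exists_isColorIso_of_type_eq {p q : MetricHoloGraph 1 s} (h : p.type = q.type) :
    ∃ φ : p.collapse.Iso q.collapse, IsColorIso p q φ ∧
      ∀ e, (φ.onE e).1 = q.1.col.symm (p.1.col e.1) := by
  obtain ⟨hZ, ψ, hψL, hψE⟩ := exists_equiv_of_typeInv_eq (p.1.comp_leg_surjective _)
    (q.1.comp_leg_surjective _) h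
  have hZ' : ∀ e, e ∈ p.zeroEdges ↔ q.1.col.symm (p.1.col e) ∈ q.zeroEdges := fun e => by
    have := Set.ext_iff.1 hZ (p.1.col e)
    simpa using this
  let φ : p.collapse.Iso q.collapse :=
    { onV := ψ
      onE := (p.1.col.trans q.1.col.symm).subtypeEquiv fun e => not_congr (hZ' e)
      ends_onE := fun e => by
        have := hψE (p.1.col e.1)
        rw [Equiv.symm_apply_apply] at this
        exact this
      leg_onV := hψL }
  refine ⟨φ, ⟨fun e => q.1.col.apply_symm_apply _, fun w => ?_⟩, fun e => rfl⟩
  ext c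
  constructor
  · rintro ⟨e, he, he', rfl⟩
    refine ⟨p.1.col.symm (q.1.col e), (hZ' _).2 (by simpa using he), ?_, p.1.col.apply_symm_apply _⟩
    refine Sym2.map.injective ψ.injective ?_
    rw [← hψE, Equiv.symm_apply_apply]
    exact he'
  · rintro ⟨e, he, he', rfl⟩
    refine ⟨q.1.col.symm (p.1.col e), (hZ' _).1 he, ?_, q.1.col.apply_symm_apply _⟩
    refine (hψE _).trans ?_
    rw [Equiv.symm_apply_apply]
    exact congrArg (Sym2.map ψ) he'

theorem sameType_iff {p q : MetricHoloGraph 1 s} : p.SameType q ↔ p.type = q.type :=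
  ⟨fun ⟨_, h⟩ => h.type_eq, fun h => (exists_isColorIso_of_type_eq h).imp fun _ h => h.1⟩

/-- The length of the edge of a given colour. -/
noncomputable def colLength (p : MetricHoloGraph 1 s) (c : Fin s) : ℝ := p.length (p.1.col.symm c)

/-- An isomorphism has no freedom on edges, since it preserves colours; hence no simplex is folded
onto itself. -/
theorem equivalent_iff {p q : MetricHoloGraph 1 s} :
    p.Equivalent q ↔ p.type = q.type ∧ p.colLength = q.colLength := by
  constructor
  · rintro ⟨φ, h, hl⟩
    refine ⟨h.type_eq, funext fun c => ?_⟩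
    by_cases hc : p.1.col.symm c ∈ p.zeroEdges
    · exact hc.trans ((h.mem_zeroEdges c).1 hc).symm
    · have h1 : q.1.col (φ.onE ⟨_, hc⟩).1 = c :=
        (h.1 ⟨_, hc⟩).trans (p.1.col.apply_symm_apply c)
      rw [← Equiv.eq_symm_apply] at h1
      rw [colLength, colLength, ← h1]
      exact (hl ⟨_, hc⟩).symm
  · rintro ⟨h, hl⟩
    obtain ⟨φ, hφ, hφ'⟩ := exists_isColorIso_of_type_eq h
    refine ⟨φ, hφ, fun e => ?_⟩
    rw [hφ']
    have := congrFun hl (p.1.col e.1)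
    simpa [colLength] using this.symm

end MetricHoloGraph


/-! ### The decomposition of the moduli space by combinatorial types -/

/-! ### Coordinates of points under maps of standard simplices. -/

namespace stdSimplex

variable {X Y : Type*} [Fintype X] [Fintype Y]

theorem map_apply_of_injective {f : X → Y} (hf : Function.Injective f) (t : stdSimplex ℝ X)
    (x : X) : map f t (f x) = t x := by
  classical
  rw [map_coe, FunOnFinite.linearMap_apply_apply, Finset.sum_eq_single x]
  · intro b hb hbx
    simp only [Finset.mem_filter, Finset.mem_univ, true_and] at hb
    exact absurd (hf hb) hbx
  · simp

theorem map_apply_of_notMem_range {f : X → Y} (t : stdSimplex ℝ X) {y : Y}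
    (hy : y ∉ Set.range f) : map f t y = 0 := by
  classical
  rw [map_coe, FunOnFinite.linearMap_apply_apply, Finset.sum_eq_zero]
  intro b hb
  simp only [Finset.mem_filter, Finset.mem_univ, true_and] at hb
  exact absurd ⟨b, hb⟩ hy

theorem map_injective {f : X → Y} (hf : Function.Injective f) :
    Function.Injective (map f : stdSimplex ℝ X → stdSimplex ℝ Y) := by
  intro t t' h
  ext x
  rw [← map_apply_of_injective hf t x, h, map_apply_of_injective hf]

theorem exists_map_eq {f : X → Y} (hf : Function.Injective f) (y : stdSimplex ℝ Y)
    (h : ∀ b ∉ Set.range f, y b = 0) : ∃ t : stdSimplex ℝ X, map f t = y ∧ ∀ x, t x = y (f x) := by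
  classical
  refine ⟨⟨fun x => y (f x), fun x => zero_le y _, ?_⟩, ?_, fun x => rfl⟩
  · rw [← sum_eq_one y, ← Finset.sum_image (s := Finset.univ) (g := f) (f := fun b => y b)
      (hf.injOn)]
    refine Finset.sum_subset (Finset.subset_univ _) fun b _ hb => h b ?_
    simpa using hb
  · ext b
    by_cases hb : b ∈ Set.range f
    · obtain ⟨x, rfl⟩ := hb
      rw [map_apply_of_injective hf]
      rfl
    · rw [map_apply_of_notMem_range _ hb, h b hb]

end stdSimplex

open Classical in
/-- The colours of the remaining edges. -/
noncomputable def TypeInv.remaining {s : ℕ} (T : TypeInv s) : Finset (Fin s) :=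
  Finset.univ.filter fun c => c ∉ T.1

namespace HoloGraph

variable {s : ℕ}

theorem mem_remaining_type {G : HoloGraph 1 s} {S : Set G.E} {c : Fin s} :
    c ∈ TypeInv.remaining (G.type S) ↔ G.col.symm c ∉ S := by
  simp only [TypeInv.remaining, Finset.mem_filter, Finset.mem_univ, true_and]
  rfl

theorem card_remaining_type (G : HoloGraph 1 s) (S : Set G.E) :
    (TypeInv.remaining (G.type S)).card = Nat.card {e // e ∉ S} := by
  rw [← Nat.card_eq_finsetCard]
  exact Nat.card_congr (G.col.symm.subtypeEquiv fun c => mem_remaining_type)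

/-- The edges of length zero, the lengths being given as a function of the colour. -/
def zeroSet (G : HoloGraph 1 s) (y : stdSimplex ℝ (Fin s)) : Set G.E := {e | y (G.col e) = 0}

theorem zeroSet_ne_univ (G : HoloGraph 1 s) (y : stdSimplex ℝ (Fin s)) :
    G.zeroSet y ≠ Set.univ := by
  intro h
  have h0 : ∀ c, y c = 0 := fun c => by
    have : G.col.symm c ∈ G.zeroSet y := h ▸ Set.mem_univ _
    simpa [zeroSet] using this
  have := stdSimplex.sum_eq_one y
  simp [h0] at this

theorem map_col_symm_apply (G : HoloGraph 1 s) (y : stdSimplex ℝ (Fin s)) (e : G.E) :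
    stdSimplex.map G.col.symm y e = y (G.col e) := by
  rw [← stdSimplex.map_apply_of_injective G.col.symm.injective y (G.col e),
    Equiv.symm_apply_apply]

/-- The metric graph with given lengths, as a function of the colour. -/
noncomputable def metric (G : HoloGraph 1 s) (y : stdSimplex ℝ (Fin s)) : MetricHoloGraph 1 s :=
  ⟨G, stdSimplex.map G.col.symm y, by
    refine G.admissible.1.isForest G.card_E_eq_card_V ?_
    simp only [map_col_symm_apply]
    exact G.zeroSet_ne_univ y⟩

theorem length_metric (G : HoloGraph 1 s) (y : stdSimplex ℝ (Fin s)) (e : G.E) :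
    (G.metric y).length e = y (G.col e) := G.map_col_symm_apply y e

theorem type_metric (G : HoloGraph 1 s) (y : stdSimplex ℝ (Fin s)) :
    (G.metric y).type = G.type (G.zeroSet y) := by
  have : (G.metric y).zeroEdges = G.zeroSet y :=
    Set.ext fun e => Eq.congr_left (z := (0 : ℝ)) (G.length_metric y e)
  exact congrArg G.type this

theorem colLength_metric (G : HoloGraph 1 s) (y : stdSimplex ℝ (Fin s)) :
    (G.metric y).colLength = y :=
  funext fun c => (G.length_metric y _).trans (congrArg y (G.col.apply_symm_apply c))

/-- The point of the moduli space with given lengths, as a function of the colour. -/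
noncomputable def point (G : HoloGraph 1 s) (y : stdSimplex ℝ (Fin s)) : MRG 1 s :=
  MRG.mk (G.metric y)

theorem point_map_col (G : HoloGraph 1 s) (x : {x : stdSimplex ℝ G.E // G.Regular x}) :
    G.point (stdSimplex.map G.col x.1) = MRG.mk ⟨G, x⟩ := by
  refine congrArg MRG.mk (congrArg (Sigma.mk G) (Subtype.ext ?_))
  change stdSimplex.map G.col.symm (stdSimplex.map G.col x.1) = x.1
  rw [stdSimplex.map_comp_apply, Equiv.symm_comp_self, stdSimplex.map_id_apply]

theorem continuous_point (G : HoloGraph 1 s) : Continuous G.point :=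
  continuous_quot_mk.comp (continuous_sigmaMk.comp
    ((stdSimplex.continuous_map (S := ℝ) G.col.symm).subtype_mk _))

end HoloGraph

namespace MRG

variable {s : ℕ}

theorem mk_eq_iff {p q : MetricHoloGraph 1 s} :
    mk p = mk q ↔ p.type = q.type ∧ p.colLength = q.colLength :=
  Quotient.eq.trans MetricHoloGraph.equivalent_iff

end MRG

namespace HoloGraph

variable {s : ℕ}

theorem point_eq_iff {G G' : HoloGraph 1 s} {y y' : stdSimplex ℝ (Fin s)} :
    G.point y = G'.point y' ↔ G.type (G.zeroSet y) = G'.type (G'.zeroSet y') ∧ y = y' := by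
  rw [point, point, MRG.mk_eq_iff, type_metric, type_metric, colLength_metric, colLength_metric,
    DFunLike.coe_fn_eq]

/-- The subsets of the edges that are realized as zero sets are the proper ones. -/
theorem exists_zeroSet_eq (G : HoloGraph 1 s) {S : Set G.E} (hS : S ≠ Set.univ) :
    ∃ y, G.zeroSet y = S := by
  classical
  obtain ⟨e, he⟩ := (Set.ne_univ_iff_exists_notMem S).1 hS
  have : Nonempty {c // G.col.symm c ∉ S} := ⟨G.col e, by simpa using he⟩
  refine ⟨stdSimplex.map (Subtype.val : {c // G.col.symm c ∉ S} → Fin s) stdSimplex.barycenter, ?_⟩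
  ext e
  by_cases he : e ∈ S
  · simp only [zeroSet, Set.mem_ofPred_eq, he, iff_true]
    exact stdSimplex.map_apply_of_notMem_range _ (by simpa using he)
  · simp only [zeroSet, Set.mem_ofPred_eq, he, iff_false]
    have h := stdSimplex.map_apply_of_injective
      (f := (Subtype.val : {c // G.col.symm c ∉ S} → Fin s)) Subtype.val_injective
      stdSimplex.barycenter ⟨G.col e, by simpa using he⟩
    rw [h]
    change ((Fintype.card _ : ℝ))⁻¹ ≠ 0
    exact inv_ne_zero (Nat.cast_ne_zero.2 Fintype.card_ne_zero)

end HoloGraph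

/-! ### Cells, characteristic maps and faces. -/

/-- The combinatorial types with `m + 1` remaining edges. -/
def Cell (s m : ℕ) : Type :=
  {T : TypeInv s // (∃ (G : HoloGraph 1 s) (S : Set G.E), G.type S = T) ∧
    T.remaining.card = m + 1}

namespace Cell

variable {s m : ℕ}

/-- The sequence of the remaining colours in increasing order. -/
noncomputable def emb (σ : Cell s m) : Fin (m + 1) ↪o Fin s := σ.1.remaining.orderEmbOfFin σ.2.2

theorem range_emb (σ : Cell s m) : Set.range σ.emb = σ.1.remaining :=
  Finset.range_orderEmbOfFin _ _

/-- A graph that represents the type. -/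
noncomputable def graph (σ : Cell s m) : HoloGraph 1 s := σ.2.1.choose

/-- The edges of the representing graph that are to be collapsed. -/
noncomputable def collapsed (σ : Cell s m) : Set σ.graph.E := σ.2.1.choose_spec.choose

theorem type_graph (σ : Cell s m) : σ.graph.type σ.collapsed = σ.1 :=
  σ.2.1.choose_spec.choose_spec

theorem mem_range_emb (σ : Cell s m) {G : HoloGraph 1 s} {S : Set G.E} (h : G.type S = σ.1)
    {c : Fin s} : c ∈ Set.range σ.emb ↔ G.col.symm c ∉ S := by
  rw [range_emb, Finset.mem_coe, ← h, HoloGraph.mem_remaining_type]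

theorem subset_zeroSet (σ : Cell s m) {G : HoloGraph 1 s} {S : Set G.E} (h : G.type S = σ.1)
    (t : stdSimplex ℝ (Fin (m + 1))) : S ⊆ G.zeroSet (stdSimplex.map σ.emb t) := fun e he =>
  stdSimplex.map_apply_of_notMem_range _ (by rw [σ.mem_range_emb h]; simpa using he)

theorem zeroSet_eq (σ : Cell s m) {G : HoloGraph 1 s} {S : Set G.E} (h : G.type S = σ.1)
    {t : stdSimplex ℝ (Fin (m + 1))} (ht : ∀ j, 0 < t j) :
    G.zeroSet (stdSimplex.map σ.emb t) = S := by
  refine Set.Subset.antisymm (fun e he => ?_) (σ.subset_zeroSet h t)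
  by_contra hS
  obtain ⟨j, hj⟩ := (σ.mem_range_emb h (c := G.col e)).2 (by simpa using hS)
  have he' : stdSimplex.map σ.emb t (G.col e) = 0 := he
  rw [← hj, stdSimplex.map_apply_of_injective σ.emb.injective] at he'
  exact (ht j).ne' he'

/-- The characteristic map. -/
noncomputable def map (σ : Cell s m) : C(stdSimplex ℝ (Fin (m + 1)), MRG 1 s) :=
  ⟨fun t => σ.graph.point (stdSimplex.map σ.emb t),
    σ.graph.continuous_point.comp (stdSimplex.continuous_map _)⟩

/-- Independence of the chosen representative, on the boundary too: there more edges are collapsed,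
and `type_congr` applies. -/
theorem map_eq (σ : Cell s m) {G : HoloGraph 1 s} {S : Set G.E} (h : G.type S = σ.1)
    (t : stdSimplex ℝ (Fin (m + 1))) : σ.map t = G.point (stdSimplex.map σ.emb t) := by
  refine HoloGraph.point_eq_iff.2 ⟨?_, rfl⟩
  refine HoloGraph.type_congr (σ.subset_zeroSet σ.type_graph t) (σ.subset_zeroSet h t)
    (fun c => ?_) (σ.type_graph.trans h.symm)
  simp [HoloGraph.zeroSet]

theorem exists_emb_eq (σ : Cell s m) (y : stdSimplex ℝ (Fin s)) {G : HoloGraph 1 s}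
    (h : G.type (G.zeroSet y) = σ.1) :
    ∃ t : stdSimplex ℝ (Fin (m + 1)), (∀ j, 0 < t j) ∧ stdSimplex.map σ.emb t = y := by
  obtain ⟨t, ht, ht'⟩ := stdSimplex.exists_map_eq σ.emb.injective y fun b hb => by
    rw [σ.mem_range_emb h, not_not] at hb
    simpa [HoloGraph.zeroSet] using hb
  refine ⟨t, fun j => lt_of_le_of_ne (stdSimplex.zero_le _ _) fun h0 => ?_, ht⟩
  have hj : σ.emb j ∈ Set.range σ.emb := ⟨j, rfl⟩
  rw [σ.mem_range_emb h] at hj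
  refine hj ?_
  simp only [HoloGraph.zeroSet, Set.mem_ofPred_eq, Equiv.apply_symm_apply]
  rw [← ht', h0]

theorem map_eq_point_iff (σ : Cell s m) {t : stdSimplex ℝ (Fin (m + 1))} (ht : ∀ j, 0 < t j)
    {G : HoloGraph 1 s} {y : stdSimplex ℝ (Fin s)} :
    σ.map t = G.point y ↔ σ.1 = G.type (G.zeroSet y) ∧ stdSimplex.map σ.emb t = y := by
  rw [σ.map_eq σ.type_graph, HoloGraph.point_eq_iff, σ.zeroSet_eq σ.type_graph ht, σ.type_graph]

theorem remaining_insert (σ : Cell s (m + 1)) (i : Fin (m + 2)) :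
    TypeInv.remaining (σ.graph.type (insert (σ.graph.col.symm (σ.emb i)) σ.collapsed)) =
      σ.1.remaining.erase (σ.emb i) := by
  ext c
  rw [HoloGraph.mem_remaining_type, Finset.mem_erase, ← σ.type_graph, HoloGraph.mem_remaining_type]
  simp [not_or]

/-- The face opposite to the `i`-th vertex: the `i`-th edge is collapsed. -/
noncomputable def face (σ : Cell s (m + 1)) (i : Fin (m + 2)) : Cell s m :=
  ⟨σ.graph.type (insert (σ.graph.col.symm (σ.emb i)) σ.collapsed), ⟨_, _, rfl⟩, by
    rw [remaining_insert, Finset.card_erase_of_mem, σ.2.2]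
    · rfl
    · rw [← Finset.mem_coe, ← range_emb]
      exact ⟨i, rfl⟩⟩

/-- Omitting one colour from an increasing enumeration leaves an increasing enumeration, and that is
unique. So ordering by colour is compatible with faces. -/
theorem emb_face (σ : Cell s (m + 1)) (i : Fin (m + 2)) :
    σ.emb ∘ i.succAbove = (σ.face i).emb := by
  refine Finset.orderEmbOfFin_unique _ (fun x => ?_)
    (σ.emb.strictMono.comp (Fin.strictMono_succAbove i))
  have : (σ.face i).1.remaining = σ.1.remaining.erase (σ.emb i) := σ.remaining_insert i
  rw [this, Finset.mem_erase]
  refine ⟨fun h => Fin.succAbove_ne i x (σ.emb.injective h), ?_⟩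
  rw [← Finset.mem_coe, ← range_emb]
  exact ⟨_, rfl⟩

theorem map_face (σ : Cell s (m + 1)) (i : Fin (m + 2)) (t : stdSimplex ℝ (Fin (m + 1))) :
    (σ.face i).map t = σ.map (stdSimplex.map i.succAbove t) := by
  rw [(σ.face i).map_eq rfl, σ.map_eq σ.type_graph, stdSimplex.map_comp_apply, emb_face]

end Cell

theorem MRG.exists_eq_point {s : ℕ} (x : MRG 1 s) : ∃ (G : HoloGraph 1 s) (y : _), x = G.point y := by
  obtain ⟨⟨G, x⟩, rfl⟩ := Quotient.exists_rep x
  exact ⟨G, _, (G.point_map_col x).symm⟩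

theorem HoloGraph.exists_cell {s : ℕ} (G : HoloGraph 1 s) {S : Set G.E} (hS : S ≠ Set.univ) :
    ∃ (m : ℕ) (σ : Cell s m), σ.1 = G.type S := by
  obtain ⟨e, he⟩ := (Set.ne_univ_iff_exists_notMem S).1 hS
  have : 0 < (TypeInv.remaining (G.type S)).card := by
    refine Finset.card_pos.2 ⟨G.col e, ?_⟩
    rw [HoloGraph.mem_remaining_type]
    simpa using he
  exact ⟨(TypeInv.remaining (G.type S)).card - 1, ⟨G.type S, ⟨G, S, rfl⟩, by omega⟩, rfl⟩

/-- The simplex of `G` is the domain of the cell in which nothing is collapsed, so the top cells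
alone detect openness in the quotient topology. -/
theorem MRG.isOpen_of_cells {s : ℕ} {A : Set (MRG 1 s)}
    (h : ∀ (m : ℕ) (σ : Cell s m), IsOpen (σ.map ⁻¹' A)) : IsOpen A := by
  change IsOpen (MRG.mk ⁻¹' A)
  rw [isOpen_sigma_iff]
  intro G
  have hne : (∅ : Set G.E) ≠ Set.univ := by
    intro h0
    have h1 := G.rank_eq
    rw [← h0, G.loopNumber_empty] at h1
    exact absurd h1 (by norm_num)
  obtain ⟨m, σ, hσ⟩ := G.exists_cell hne
  -- With nothing collapsed all colours remain, so `σ.emb` has a right inverse that translates edge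
  -- lengths into coordinates of the cell.
  have hsurj : Function.Surjective σ.emb := fun c => (σ.mem_range_emb hσ.symm).2 (by simp)
  have hcont : Continuous fun x : {x : stdSimplex ℝ G.E // G.Regular x} =>
      stdSimplex.map (Function.surjInv hsurj) (stdSimplex.map G.col x.1) :=
    (stdSimplex.continuous_map _).comp ((stdSimplex.continuous_map _).comp continuous_subtype_val)
  convert (h m σ).preimage hcont using 1
  ext x
  simp only [Set.mem_preimage]
  rw [σ.map_eq hσ.symm, stdSimplex.map_comp_apply _ σ.emb,
    (Function.rightInverse_surjInv hsurj).comp_eq_id, stdSimplex.map_id_apply, G.point_map_col]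

/-- The decomposition of the moduli space by combinatorial types. -/
noncomputable def MRG.deltaComplex (s : ℕ) : DeltaComplex (MRG 1 s) where
  simplex m := ULift.{1} (Cell s m)
  map σ := σ.down.map
  face σ i := ⟨σ.down.face i⟩
  map_face σ i t := σ.down.map_face i t
  existsUnique_interior x := by
    obtain ⟨G, y, rfl⟩ := x.exists_eq_point
    obtain ⟨m, σ, hσ⟩ := G.exists_cell (G.zeroSet_ne_univ y)
    obtain ⟨t, ht, hty⟩ := σ.exists_emb_eq y hσ.symm
    refine ⟨⟨m, ⟨σ⟩, t⟩, ⟨ht, (σ.map_eq_point_iff ht).2 ⟨hσ, hty⟩⟩, ?_⟩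
    rintro ⟨m', ⟨σ'⟩, t'⟩ ⟨ht', h⟩
    obtain ⟨h1, h2⟩ := (σ'.map_eq_point_iff ht').1 h
    have h3 : σ'.1 = σ.1 := h1.trans hσ.symm
    obtain rfl : m' = m := by
      have := σ'.2.2
      rw [h3, σ.2.2] at this
      omega
    obtain rfl : σ' = σ := Subtype.ext h3
    obtain rfl : t' = t := stdSimplex.map_injective σ'.emb.injective (h2.trans hty.symm)
    rfl
  isOpen_iff A := ⟨fun h _ σ => h.preimage σ.down.map.continuous,
    fun h => MRG.isOpen_of_cells fun m σ => h m ⟨σ⟩⟩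

theorem MRG.mem_openSimplex_iff {s m : ℕ} (p : MetricHoloGraph 1 s)
    (σ : (MRG.deltaComplex s).simplex m) :
    MRG.mk p ∈ (MRG.deltaComplex s).openSimplex σ ↔ σ.down.1 = p.type := by
  obtain ⟨G, x⟩ := p
  have hp := G.point_map_col x
  have htype : G.type (G.zeroSet (stdSimplex.map G.col x.1)) =
      MetricHoloGraph.type (⟨G, x⟩ : MetricHoloGraph 1 s) := by
    rw [← G.type_metric]
    exact (MRG.mk_eq_iff.1 hp).1
  rw [← hp, ← htype]
  constructor
  · rintro ⟨t, ht, h⟩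
    exact ((σ.down.map_eq_point_iff ht).1 h).1
  · intro h
    obtain ⟨t, ht, hty⟩ := σ.down.exists_emb_eq _ h.symm
    exact ⟨t, ht, (σ.down.map_eq_point_iff ht).2 ⟨h, hty⟩⟩

theorem MetricHoloGraph.zeroEdges_ne_univ {s : ℕ} (p : MetricHoloGraph 1 s) :
    p.zeroEdges ≠ Set.univ := by
  intro h
  have h1 := p.1.rank_eq
  rw [← h] at h1
  have h2 : p.1.loopNumber p.zeroEdges = 0 := p.2.2
  rw [h2] at h1
  exact absurd h1 (by norm_num)

theorem MRG.isGraphDecomposition_deltaComplex (s : ℕ) :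
    (MRG.deltaComplex s).IsGraphDecomposition := by
  refine ⟨fun p q => ?_, fun p m σ h => ?_⟩
  · rw [MetricHoloGraph.sameType_iff]
    simp only [mem_openSimplex_iff]
    constructor
    · rintro ⟨m, σ, h1, h2⟩
      exact h1.symm.trans h2
    · intro h
      obtain ⟨m, σ, hσ⟩ := p.1.exists_cell p.zeroEdges_ne_univ
      exact ⟨m, ⟨σ⟩, hσ, hσ.trans h⟩
  · rw [mem_openSimplex_iff] at h
    rw [← σ.down.2.2, h]
    exact (p.1.card_remaining_type p.zeroEdges).symm

/-- The simplices of a decomposition by graphs are the combinatorial types. -/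
theorem DeltaComplex.IsGraphDecomposition.nonempty_equiv {s : ℕ} {D : DeltaComplex (MRG 1 s)}
    (hD : D.IsGraphDecomposition) (m : ℕ) : Nonempty (D.simplex m ≃ Cell s m) := by
  have hex : ∀ σ : D.simplex m, ∃ p : MetricHoloGraph 1 s, MRG.mk p ∈ D.openSimplex σ := by
    intro σ
    obtain ⟨p, hp⟩ := Quotient.exists_rep (D.map σ stdSimplex.barycenter)
    refine ⟨p, stdSimplex.barycenter, fun j => ?_, hp.symm⟩
    change (0 : ℝ) < ((Fintype.card (Fin (m + 1)) : ℝ))⁻¹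
    exact inv_pos.2 (Nat.cast_pos.2 Fintype.card_pos)
  have huniq : ∀ {x : MRG 1 s} {m m' : ℕ} {σ : D.simplex m} {σ' : D.simplex m'},
      x ∈ D.openSimplex σ → x ∈ D.openSimplex σ' →
      (⟨m, σ⟩ : Σ m, D.simplex m) = ⟨m', σ'⟩ := by
    rintro x m m' σ σ' ⟨t, ht, h⟩ ⟨t', ht', h'⟩
    have := (D.existsUnique_interior x).unique (y₁ := ⟨m, σ, t⟩) (y₂ := ⟨m', σ', t'⟩) ⟨ht, h⟩
      ⟨ht', h'⟩
    exact congrArg (fun a : Σ n : ℕ, D.simplex n × stdSimplex ℝ (Fin (n + 1)) =>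
      (⟨a.1, a.2.1⟩ : Σ m, D.simplex m)) this
  choose p hp using hex
  -- A simplex goes to the type of any interior point. Points of equal type share an open simplex,
  -- and open simplices are disjoint.
  let f : D.simplex m → Cell s m := fun σ => ⟨(p σ).type, ⟨_, _, rfl⟩, by
    rw [← hD.2 _ _ _ (hp σ)]
    exact (p σ).1.card_remaining_type _⟩
  refine ⟨Equiv.ofBijective f ⟨fun σ σ' h => ?_, fun τ => ?_⟩⟩
  · obtain ⟨m', ρ, h1, h2⟩ := (hD.1 (p σ) (p σ')).2
      (MetricHoloGraph.sameType_iff.2 (congrArg Subtype.val h))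
    have := (huniq (hp σ) h1).trans (huniq h2 (hp σ'))
    simpa using this
  · obtain ⟨T, ⟨G, S, rfl⟩, hT⟩ := τ
    have hS : S ≠ Set.univ := by
      rintro rfl
      rw [G.card_remaining_type] at hT
      simp at hT
    obtain ⟨y, hy⟩ := G.exists_zeroSet_eq hS
    obtain ⟨⟨m', σ, t⟩, ⟨ht, h⟩, -⟩ := D.existsUnique_interior (G.point y)
    have hmem : MRG.mk (G.metric y) ∈ D.openSimplex σ := ⟨t, ht, h⟩
    have htype : (G.metric y).type = G.type S := by rw [G.type_metric, hy]
    obtain rfl : m' = m := by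
      have h1 := hD.2 _ _ _ hmem
      have h2 := (G.metric y).1.card_remaining_type (G.metric y).zeroEdges
      have h3 : (G.metric y).1.type (G.metric y).zeroEdges = G.type S := htype
      rw [h3, hT] at h2
      have h4 := h2.trans h1
      omega
    refine ⟨σ, Subtype.ext ?_⟩
    have := MetricHoloGraph.sameType_iff.1 ((hD.1 _ _).1 ⟨_, σ, hp σ, hmem⟩)
    exact this.trans htype


/-! ### The Euler characteristic of a finite Δ-complex -/

namespace DeltaComplex

variable {X : Type*} [TopologicalSpace X] (D : DeltaComplex X)

/-- The barycenter is an interior point of only one simplex. The structure does not assume the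
semi-simplicial identities; they follow from this. -/
theorem simplex_eq_of_map_eq {n : ℕ} {σ τ : D.simplex n} (h : ∀ t, D.map σ t = D.map τ t) :
    σ = τ := by
  have hpos : ∀ j : Fin (n + 1), 0 < (stdSimplex.barycenter : stdSimplex ℝ (Fin (n + 1))) j := by
    intro j
    change (0 : ℝ) < ((Fintype.card (Fin (n + 1)) : ℝ))⁻¹
    exact inv_pos.2 (Nat.cast_pos.2 Fintype.card_pos)
  have := (D.existsUnique_interior (D.map τ stdSimplex.barycenter)).unique
    (y₁ := ⟨n, σ, stdSimplex.barycenter⟩) (y₂ := ⟨n, τ, stdSimplex.barycenter⟩)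
    ⟨hpos, h _⟩ ⟨hpos, rfl⟩
  simpa using this

/-- Two vertices may be deleted in either order; this form makes the exchange of orders an
involution on pairs `(i, j)`. -/
theorem face_face {n : ℕ} (σ : D.simplex (n + 2)) (i : Fin (n + 3)) (j : Fin (n + 2)) :
    D.face (D.face σ (i.succAbove j)) (j.predAbove i) = D.face (D.face σ i) j := by
  refine D.simplex_eq_of_map_eq fun t => ?_
  simp only [D.map_face, stdSimplex.map_comp_apply]
  congr 2
  funext k
  exact Fin.succAbove_succAbove_succAbove_predAbove i j k

theorem boundary_single {n : ℕ} (σ : D.simplex (n + 1)) :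
    D.boundary n (Finsupp.single σ 1) =
      ∑ i : Fin (n + 2), (-1 : ℚ) ^ (i : ℕ) • Finsupp.single (D.face σ i) (1 : ℚ) := by
  simp [boundary, Finsupp.linearCombination_single]

theorem boundary_comp_boundary (n : ℕ) : D.boundary n ∘ₗ D.boundary (n + 1) = 0 := by
  refine Finsupp.lhom_ext' fun σ => LinearMap.ext_ring ?_
  simp only [LinearMap.comp_apply, Finsupp.lsingle_apply, LinearMap.zero_apply]
  rw [boundary_single, map_sum]
  simp only [map_smul, boundary_single, Finset.smul_sum, smul_smul, ← pow_add]
  rw [← Finset.sum_product', Finset.univ_product_univ]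
  -- The two orders of deletion give the same face with opposite signs.
  refine Finset.sum_involution
    (fun (x : Fin (n + 3) × Fin (n + 2)) _ => (x.1.succAbove x.2, x.2.predAbove x.1))
    (fun x _ => ?_) (fun x _ _ h => Fin.succAbove_ne x.1 x.2 (congrArg Prod.fst h))
    (fun _ _ => Finset.mem_univ _) (fun x _ => ?_)
  · simp only [face_face, Fin.neg_one_pow_succAbove_add_predAbove, neg_smul, add_neg_cancel]
  · simp only [Fin.succAbove_succAbove_predAbove, Fin.predAbove_predAbove_succAbove]

theorem range_boundary_le_cycles (n : ℕ) : LinearMap.range (D.boundary n) ≤ D.cycles n := by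
  cases n with
  | zero => exact le_top
  | succ n => exact LinearMap.range_le_ker_iff.2 (D.boundary_comp_boundary n)

/-- The rank of the boundary operator that starts in dimension `n`. -/
noncomputable def boundaryRank : ℕ → ℕ
  | 0 => 0
  | n + 1 => Module.finrank ℚ (LinearMap.range (D.boundary n))

/-- Rank-nullity for the boundary out of degree `n`, combined with the dimension of the homology
quotient. -/
theorem betti_add [∀ n, Finite (D.simplex n)] (n : ℕ) :
    D.betti n + D.boundaryRank (n + 1) + D.boundaryRank n = Nat.card (D.simplex n) := by
  have h1 := ((LinearMap.range (D.boundary n)).submoduleOf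
    (D.cycles n)).finrank_quotient_add_finrank
  rw [(Submodule.submoduleOfEquivOfLe (D.range_boundary_le_cycles n)).finrank_eq] at h1
  have h2 : ∀ m, Module.finrank ℚ (D.simplex m →₀ ℚ) = Nat.card (D.simplex m) := fun m => by
    have := Fintype.ofFinite (D.simplex m)
    rw [Module.finrank_finsupp_self, Nat.card_eq_fintype_card]
  have h3 : Module.finrank ℚ (D.cycles n) + D.boundaryRank n = Nat.card (D.simplex n) := by
    rw [← h2]
    cases n with
    | zero => exact (add_zero _).trans (finrank_top ℚ _)
    | succ n => rw [add_comm]; exact (D.boundary n).finrank_range_add_finrank_ker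
  rw [← h3, ← h1]
  rfl

theorem eulerChar_eq_sum [∀ n, Finite (D.simplex n)] {N : ℕ}
    (hN : ∀ n, N ≤ n → IsEmpty (D.simplex n)) :
    D.eulerChar = ∑ n ∈ Finset.range N, (-1 : ℤ) ^ n * (Nat.card (D.simplex n) : ℤ) := by
  have hzero : ∀ n, N ≤ n → D.betti n = 0 ∧ D.boundaryRank n = 0 := fun n hn => by
    have h1 := D.betti_add n
    have := hN n hn
    rw [Nat.card_of_isEmpty] at h1
    omega
  have h1 : D.eulerChar = ∑ n ∈ Finset.range N, (-1 : ℤ) ^ n * (D.betti n : ℤ) := by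
    refine finsum_eq_sum_of_support_subset _ fun n hn => ?_
    rw [Finset.coe_range, Set.mem_Iio]
    by_contra h
    exact hn (by simp [(hzero n (not_lt.1 h)).1])
  -- The boundary ranks telescope, and the surviving term vanishes at `M = N`.
  have h2 : ∀ M, ∑ n ∈ Finset.range M, (-1 : ℤ) ^ n *
      ((D.boundaryRank (n + 1) : ℤ) + D.boundaryRank n) = -(-1) ^ M * D.boundaryRank M := by
    intro M
    induction M with
    | zero => simp [boundaryRank]
    | succ M ih => rw [Finset.sum_range_succ, ih]; ring
  have h3 := h2 N
  rw [(hzero N le_rfl).2, Nat.cast_zero, mul_zero] at h3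
  rw [h1, ← add_zero (∑ n ∈ Finset.range N, (-1 : ℤ) ^ n * (D.betti n : ℤ)), ← h3,
    ← Finset.sum_add_distrib]
  refine Finset.sum_congr rfl fun n _ => ?_
  rw [← D.betti_add n]
  push_cast
  ring

end DeltaComplex


/-! ### Labelled cycles -/

/-- The end points of an edge of a cycle with vertex set `ZMod k`: `inl a` is the edge from `a` to
`a + 1`, and `inr a` is an edge that has been collapsed to the vertex `a`. -/
def cycEnds {k : ℕ} : ZMod k ⊕ ZMod k → Sym2 (ZMod k)
  | .inl a => s(a, a + 1)
  | .inr a => s(a, a)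

/-- The ways to distribute `s` legs and `s` colours over the edges and vertices of a cycle of
length `k` such that each edge has one colour and each vertex carries one leg more than
remembered colours. -/
def LabelledCycle (s k : ℕ) : Type :=
  {x : (Fin s → ZMod k) × (Fin s → ZMod k ⊕ ZMod k) //
    ∀ j, Nat.card {i // x.1 i = j} = Nat.card {c // x.2 c = .inr j} + 1 ∧
      Nat.card {c // x.2 c = .inl j} = 1}

namespace LabelledCycle

variable {s k : ℕ}

/-- The combinatorial type of a labelled cycle. -/
def type (x : LabelledCycle s k) : TypeInv s :=
  typeInv {c | (x.1.2 c).isRight} x.1.1 (cycEnds ∘ x.1.2)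

theorem leg_surjective (x : LabelledCycle s k) : Function.Surjective x.1.1 := fun j => by
  have h : 0 < Nat.card {i // x.1.1 i = j} := by rw [(x.2 j).1]; omega
  obtain ⟨i, hi⟩ := (Nat.card_pos_iff.1 h).1
  exact ⟨i, hi⟩

theorem existsUnique_color (x : LabelledCycle s k) (j : ZMod k) : ∃! c, x.1.2 c = .inl j := by
  obtain ⟨⟨h1⟩, ⟨c, hc⟩⟩ := Nat.card_eq_one_iff_unique.1 (x.2 j).2
  exact ⟨c, hc, fun c' hc' => congrArg Subtype.val (h1 ⟨c', hc'⟩ ⟨c, hc⟩)⟩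

theorem card_remaining {m : ℕ} (x : LabelledCycle s (m + 1)) :
    x.type.remaining.card = m + 1 := by
  choose g hg hg' using x.existsUnique_color
  have : Function.Bijective fun j =>
      (⟨g j, by simp [TypeInv.remaining, type, typeInv, hg]⟩ : x.type.remaining) := by
    constructor
    · intro j j' h
      have := congrArg (fun c => x.1.2 c.1) h
      simpa [hg] using this
    · rintro ⟨c, hc⟩
      simp only [TypeInv.remaining, type, typeInv, Set.mem_ofPred_eq] at hc
      obtain ⟨j, hj⟩ : ∃ j, x.1.2 c = .inl j := by
        cases h : x.1.2 c with
        | inl j => exact ⟨j, rfl⟩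
        | inr j => simp [h] at hc
      exact ⟨j, Subtype.ext (hg' j c hj).symm⟩
  rw [← Nat.card_eq_finsetCard, ← Nat.card_congr (Equiv.ofBijective _ this)]
  exact Nat.card_zmod _

end LabelledCycle

/-! ### Automorphisms of a cycle and their action on labellings. -/

/-- The automorphisms of a cycle as a multigraph. -/
def CycleAut (k : ℕ) : Type :=
  {φ : Equiv.Perm (ZMod k) × Equiv.Perm (ZMod k) //
    ∀ a, s(φ.2 a, φ.2 a + 1) = s(φ.1 a, φ.1 (a + 1))}

namespace CycleAut

/-- Flipping the loop moves neither its edge nor its vertex, so it is invisible here; this is the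
origin of `δ_{1,k}`. -/
theorem card_one : Nat.card (CycleAut 1) = 1 := by
  have : Subsingleton (CycleAut 1) :=
    ⟨fun φ ψ => Subtype.ext (Prod.ext (Equiv.ext fun _ => Subsingleton.elim (α := Fin 1) _ _)
      (Equiv.ext fun _ => Subsingleton.elim (α := Fin 1) _ _))⟩
  have : Nonempty (CycleAut 1) := ⟨⟨(1, 1), fun a => rfl⟩⟩
  exact Nat.card_eq_one_iff_unique.2 ⟨inferInstance, inferInstance⟩

variable {k : ℕ}

/-- Rotations. -/
def rotation (a : ZMod k) : CycleAut k :=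
  ⟨(Equiv.addLeft a, Equiv.addLeft a), fun i => by simp [add_assoc]⟩

/-- Reflections. -/
def reflection (a : ZMod k) : CycleAut k :=
  ⟨(Equiv.subLeft a, Equiv.subLeft (a - 1)), fun i => by
    simp only [Equiv.subLeft_apply]
    exact Sym2.eq_iff.2 (Or.inr ⟨by ring, by ring⟩)⟩

theorem eq_rotation [NeZero k] (h1 : (1 : ZMod k) ≠ 0) (φ : CycleAut k)
    (h : φ.1.2 0 = φ.1.1 0) : φ = rotation (φ.1.1 0) := by
  have key : ∀ n : ℕ, φ.1.1 n = φ.1.1 0 + n ∧ φ.1.2 n = φ.1.1 0 + n := by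
    intro n
    induction n with
    | zero => simp [h]
    | succ n ih =>
      have hn := φ.2 n
      rw [ih.1, ih.2, Sym2.congr_right] at hn
      have hv : φ.1.1 ((n : ZMod k) + 1) = φ.1.1 0 + (n + 1) := by rw [← hn, add_assoc]
      have hn' := φ.2 ((n : ZMod k) + 1)
      have hmem : φ.1.1 ((n : ZMod k) + 1) ∈ s(φ.1.2 (n + 1), φ.1.2 (n + 1) + 1) := by
        rw [hn']; exact Sym2.mem_mk_left _ _
      push_cast
      refine ⟨hv, ?_⟩
      -- Reversing direction at this point would send edges `n` and `n + 1` to the same edge.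
      rcases Sym2.mem_iff.1 hmem with h2 | h2
      · rw [← h2, hv]
      · rw [hv, ← add_assoc, add_left_inj, ← ih.2] at h2
        exact absurd (φ.1.2.injective h2) (by simpa using h1)
  refine Subtype.ext (Prod.ext (Equiv.ext fun a => ?_) (Equiv.ext fun a => ?_))
  · have := (key a.val).1
    rwa [ZMod.natCast_zmod_val] at this
  · have := (key a.val).2
    rwa [ZMod.natCast_zmod_val] at this

theorem eq_reflection [NeZero k] (h1 : (1 : ZMod k) ≠ 0) (φ : CycleAut k)
    (h : φ.1.2 0 + 1 = φ.1.1 0) : φ = reflection (φ.1.1 0) := by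
  have key : ∀ n : ℕ, φ.1.1 n = φ.1.1 0 - n ∧ φ.1.2 n = φ.1.1 0 - 1 - n := by
    intro n
    induction n with
    | zero => simp [← h]
    | succ n ih =>
      have hn := φ.2 n
      rw [ih.1, ih.2, Sym2.eq_swap, show φ.1.1 0 - 1 - (n : ZMod k) + 1 = φ.1.1 0 - n by ring,
        Sym2.congr_right] at hn
      have hv : φ.1.1 ((n : ZMod k) + 1) = φ.1.1 0 - (n + 1) := by rw [← hn]; ring
      have hn' := φ.2 ((n : ZMod k) + 1)
      have hmem : φ.1.1 ((n : ZMod k) + 1) ∈ s(φ.1.2 (n + 1), φ.1.2 (n + 1) + 1) := by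
        rw [hn']; exact Sym2.mem_mk_left _ _
      push_cast
      refine ⟨hv, ?_⟩
      rcases Sym2.mem_iff.1 hmem with h2 | h2
      · rw [← hn, ← ih.2] at h2
        exact absurd (φ.1.2.injective h2.symm) (by simpa using h1)
      · rw [hv] at h2
        rw [eq_sub_of_add_eq h2.symm]
        ring
  refine Subtype.ext (Prod.ext (Equiv.ext fun a => ?_) (Equiv.ext fun a => ?_))
  · have := (key a.val).1
    rwa [ZMod.natCast_zmod_val] at this
  · have := (key a.val).2
    rwa [ZMod.natCast_zmod_val] at this

/-- The image of edge `0` either starts or ends at the image of vertex `0`, which decides between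
rotation and reflection. For `k = 2` the vertex permutations coincide and only the edge permutation
tells them apart. -/
theorem card_of_two_le (hk : 2 ≤ k) : Nat.card (CycleAut k) = 2 * k := by
  have : NeZero k := ⟨by omega⟩
  have : Fact (1 < k) := ⟨hk⟩
  have h1 : (1 : ZMod k) ≠ 0 := one_ne_zero
  let f : ZMod k ⊕ ZMod k → CycleAut k := Sum.elim rotation reflection
  have hf : Function.Bijective f := by
    constructor
    · rintro (a | a) (b | b) h
      · have := congrArg (fun φ : CycleAut k => φ.1.1 0) h
        simpa [f, rotation] using this
      · have h2 : a + 0 = b - 0 := congrArg (fun φ : CycleAut k => φ.1.1 0) h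
        have h3 : a + 0 = b - 1 - 0 := congrArg (fun φ : CycleAut k => φ.1.2 0) h
        exact absurd (by linear_combination h2.symm.trans h3) h1
      · have h2 : a - 0 = b + 0 := congrArg (fun φ : CycleAut k => φ.1.1 0) h
        have h3 : a - 1 - 0 = b + 0 := congrArg (fun φ : CycleAut k => φ.1.2 0) h
        exact absurd (by linear_combination h2.trans h3.symm) h1
      · have := congrArg (fun φ : CycleAut k => φ.1.1 0) h
        simpa [f, reflection] using this
    · intro φ
      have hmem : φ.1.1 0 ∈ s(φ.1.2 0, φ.1.2 0 + 1) := by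
        rw [φ.2 0]; exact Sym2.mem_mk_left _ _
      rcases Sym2.mem_iff.1 hmem with h | h
      · exact ⟨.inl _, (φ.eq_rotation h1 h.symm).symm⟩
      · exact ⟨.inr _, (φ.eq_reflection h1 h.symm).symm⟩
  rw [← Nat.card_congr (Equiv.ofBijective f hf), Nat.card_sum, Nat.card_zmod]
  omega

end CycleAut

namespace LabelledCycle

variable {s k : ℕ}

/-- An automorphism of the cycle acts on the labellings. -/
def act (x : LabelledCycle s k) (φ : CycleAut k) : LabelledCycle s k :=
  ⟨(φ.1.1 ∘ x.1.1, Sum.map φ.1.2 φ.1.1 ∘ x.1.2), fun j => by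
    have h1 : ∀ i, (φ.1.1 ∘ x.1.1) i = j ↔ x.1.1 i = φ.1.1.symm j := fun i => by
      simp [Equiv.eq_symm_apply]
    have h2 : ∀ c, (Sum.map φ.1.2 φ.1.1 ∘ x.1.2) c = .inr j ↔ x.1.2 c = .inr (φ.1.1.symm j) :=
      fun c => by
        cases h : x.1.2 c <;> simp [h, Equiv.eq_symm_apply]
    have h3 : ∀ c, (Sum.map φ.1.2 φ.1.1 ∘ x.1.2) c = .inl j ↔ x.1.2 c = .inl (φ.1.2.symm j) :=
      fun c => by
        cases h : x.1.2 c <;> simp [h, Equiv.eq_symm_apply]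
    simp only [h1, h2, h3]
    exact ⟨(x.2 _).1, (x.2 _).2⟩⟩

theorem type_act (x : LabelledCycle s k) (φ : CycleAut k) : (x.act φ).type = x.type := by
  refine (typeInv_congr (h := φ.1.1) φ.1.1.injective ?_ (fun _ => rfl) fun c => ?_).symm
  · ext c
    cases h : x.1.2 c <;> simp [act, h]
  · cases h : x.1.2 c with
    | inl a => simpa [act, h, cycEnds] using φ.2 a
    | inr a => simp [act, h, cycEnds]

/-- The action is free because every vertex carries a leg and every edge a colour. -/
theorem act_injective (x : LabelledCycle s k) : Function.Injective x.act := by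
  intro φ ψ h
  refine Subtype.ext (Prod.ext (Equiv.ext fun a => ?_) (Equiv.ext fun a => ?_))
  · obtain ⟨i, rfl⟩ := x.leg_surjective a
    exact congrFun (congrArg (fun y => y.1.1) h) i
  · obtain ⟨c, hc, -⟩ := x.existsUnique_color a
    have := congrFun (congrArg (fun y => y.1.2) h) c
    simpa [act, hc] using this

/-- Legs determine the vertex permutation `ψ`, colours the edge permutation `η`. -/
theorem exists_act_eq [NeZero k] {x y : LabelledCycle s k} (h : y.type = x.type) :
    ∃ φ, x.act φ = y := by
  obtain ⟨hZ, ψ, hψL, hψE⟩ := exists_equiv_of_typeInv_eq x.leg_surjective y.leg_surjective h.symm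
  have hZ' : ∀ c, (x.1.2 c).isRight = (y.1.2 c).isRight := fun c => by
    rw [Bool.eq_iff_iff]; exact Set.ext_iff.1 hZ c
  choose g hg hg' using x.existsUnique_color
  have hl : ∀ a, ∃ b, y.1.2 (g a) = .inl b := fun a => by
    have := hZ' (g a)
    rw [hg] at this
    cases h : y.1.2 (g a) with
    | inl b => exact ⟨b, rfl⟩
    | inr b => simp [h] at this
  choose η hη using hl
  have hinj : Function.Injective η := by
    intro a a' haa
    have : g a = g a' := (y.existsUnique_color (η a)).unique (hη a) (haa ▸ hη a')
    have := congrArg x.1.2 this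
    rw [hg, hg] at this
    exact Sum.inl_injective this
  have hbij := Finite.injective_iff_bijective.1 hinj
  refine ⟨⟨(ψ, Equiv.ofBijective η hbij), fun a => ?_⟩, ?_⟩
  · have := hψE (g a)
    simp only [Function.comp_apply, hg, hη, cycEnds, Sym2.map_mk] at this
    exact this
  · refine Subtype.ext (Prod.ext (funext fun i => (hψL i).symm) (funext fun c => ?_))
    change Sum.map η ψ (x.1.2 c) = y.1.2 c
    cases hc : x.1.2 c with
    | inl a =>
      rw [hg' a c hc, hη]
      rfl
    | inr a =>
      have h1 := hZ' c
      have h2 := hψE c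
      cases hc' : y.1.2 c with
      | inl b => simp [hc, hc'] at h1
      | inr b =>
        simp only [Function.comp_apply, hc, hc', cycEnds, Sym2.map_mk] at h2
        rcases Sym2.eq_iff.1 h2 with h | h <;> simp [h.1]

theorem card_type_eq [NeZero k] (x : LabelledCycle s k) :
    Nat.card {y : LabelledCycle s k // y.type = x.type} = Nat.card (CycleAut k) := by
  refine (Nat.card_congr (Equiv.ofBijective
    (fun φ => (⟨x.act φ, x.type_act φ⟩ : {y : LabelledCycle s k // y.type = x.type}))
    ⟨fun φ ψ h => x.act_injective (congrArg Subtype.val h), fun y => ?_⟩)).symm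
  obtain ⟨φ, hφ⟩ := exists_act_eq y.2
  exact ⟨φ, Subtype.ext hφ⟩

end LabelledCycle

/-- Each combinatorial type comes from a labelled cycle. -/
theorem Cell.exists_labelledCycle {s m : ℕ} (σ : Cell s m) :
    ∃ x : LabelledCycle s (m + 1), x.type = σ.1 := by
  classical
  obtain ⟨T, ⟨G, S, rfl⟩, hT⟩ := σ
  rw [G.card_remaining_type] at hT
  have hS : S ≠ Set.univ := by
    rintro rfl
    simp at hT
  have hf := G.admissible.1.isForest G.card_E_eq_card_V hS
  obtain ⟨v, e, hve⟩ := (LegGraph.contract_isOnePI G.admissible.1 S).exists_cyclic_enumeration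
    (m := m) hT ((hf.card_comp G.card_E_eq_card_V).trans hT)
  -- `G / S` is a cycle; each colour is placed on its remaining edge or at the vertex to which its
  -- edge was collapsed.
  have hC : ∀ c : Fin s, ∃ z : ZMod (m + 1) ⊕ ZMod (m + 1),
      (G.col.symm c ∈ S → ∃ j, z = .inr j ∧
        (G.ends (G.col.symm c)).map (G.comp S) = s(v j, v j)) ∧
      ∀ h : G.col.symm c ∉ S, z = .inl (e.symm ⟨_, h⟩) := by
    intro c
    by_cases h : G.col.symm c ∈ S
    · induction h' : G.ends (G.col.symm c) with | _ x y =>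
      refine ⟨.inr (v.symm (G.comp S x)), fun _ => ⟨_, rfl, ?_⟩, fun h' => absurd h h'⟩
      rw [Sym2.map_mk, ← LegGraph.comp_eq_of_mem h h']
      exact congrArg (fun z => s(z, z)) (v.apply_symm_apply _).symm
    · exact ⟨.inl (e.symm ⟨_, h⟩), fun h' => absurd h' h, fun _ => rfl⟩
  choose C hC1 hC2 using hC
  have hinl : ∀ j c, C c = .inl j ↔ c = G.col (e j).1 := by
    intro j c
    by_cases h : G.col.symm c ∈ S
    · obtain ⟨j', hj', -⟩ := hC1 c h
      rw [hj']
      simp only [reduceCtorEq, false_iff]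
      rintro rfl
      rw [Equiv.symm_apply_apply] at h
      exact (e j).2 h
    · rw [hC2 c h, Sum.inl.injEq]
      exact (e.symm_apply_eq (x := ⟨_, h⟩)).trans
        ⟨fun h1 => G.col.symm_apply_eq.1 (congrArg Subtype.val h1),
          fun h1 => Subtype.ext (G.col.symm_apply_eq.2 h1)⟩
  have hinr : ∀ j c, C c = .inr j ↔
      G.col.symm c ∈ S ∧ (G.ends (G.col.symm c)).map (G.comp S) = s(v j, v j) := by
    intro j c
    by_cases h : G.col.symm c ∈ S
    · obtain ⟨j', hj', h'⟩ := hC1 c h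
      rw [hj', Sum.inr.injEq]
      refine ⟨fun h1 => ⟨h, h1 ▸ h'⟩, fun h1 => ?_⟩
      have := h'.symm.trans h1.2
      rcases Sym2.eq_iff.1 this with h2 | h2 <;> exact v.injective h2.1
    · rw [hC2 c h]
      simp [h]
  let L : Fin s → ZMod (m + 1) := fun i => v.symm (G.comp S (G.leg i))
  refine ⟨⟨(L, C), fun j => ⟨?_, ?_⟩⟩, ?_⟩
  -- Legs at `j` count the original vertices in that component, a tree with one edge fewer than
  -- vertices.
  · have h1 : Nat.card {i // L i = j} = Nat.card {u // G.comp S u = v j} :=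
      Nat.card_congr ((Equiv.ofBijective _ G.leg_bijective).subtypeEquiv fun i =>
        v.symm_apply_eq)
    have h2 : Nat.card {c // C c = .inr j} =
        Nat.card {e // e ∈ S ∧ (G.ends e).map (G.comp S) = s(v j, v j)} :=
      Nat.card_congr (G.col.symm.subtypeEquiv fun c => hinr j c)
    rw [h1, h2]
    exact (hf.card_component (v j)).symm
  · simp only [hinl]
    simp
  · refine typeInv_congr (h := v) v.injective ?_ (fun i => (v.apply_symm_apply _).symm) fun c => ?_
    · ext c
      by_cases h : G.col.symm c ∈ S
      · obtain ⟨j, hj, -⟩ := hC1 c h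
        simp [hj, h]
      · simp [hC2 c h, h]
    · by_cases h : G.col.symm c ∈ S
      · obtain ⟨j, hj, h'⟩ := hC1 c h
        simp only [Function.comp_apply, hj, cycEnds, h', Sym2.map_mk]
      · simp only [Function.comp_apply, hC2 c h, cycEnds, Sym2.map_mk]
        have := hve (e.symm ⟨_, h⟩)
        exact (congrArg (G.contract S).ends (e.apply_symm_apply ⟨_, h⟩)).symm.trans this

/-! ### Realization of labelled cycles -/

namespace LegGraph

variable {s : ℕ} {V : Type} [Fintype V] [Nonempty V] {f : V → V} {leg : Fin s → V}

/-- The graph with an edge from `x` to `f x` for each vertex `x`. -/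
def ofMap (f : V → V) (leg : Fin s → V) : LegGraph s where
  V := V
  E := V
  ends x := s(x, f x)
  leg := leg

theorem ofMap_isOnePI (hf : ∀ x y, ∃ t, f^[t] x = y) : (ofMap f leg).IsOnePI := by
  classical
  have key : ∀ e : V, (ofMap f leg).ConnectedOn {e}ᶜ := by
    intro e
    suffices h : ∀ u : V, (ofMap f leg).comp {e}ᶜ (f e) = (ofMap f leg).comp {e}ᶜ u from
      fun u v => (h u).symm.trans (h v)
    intro u
    have hu := hf (f e) u
    -- The shortest route from `f e` to `u` avoids the edge `e`: using it would lead back to `f e`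
    -- and leave a shorter route.
    set t := Nat.find hu with ht
    have htu : f^[t] (f e) = u := Nat.find_spec hu
    have hind : ∀ i ≤ t, (ofMap f leg).comp {e}ᶜ (f e) = (ofMap f leg).comp {e}ᶜ (f^[i] (f e)) := by
      intro i
      induction i with
      | zero => intro _; rfl
      | succ i ih =>
        intro hi
        refine (ih (by omega)).trans (comp_eq_of_mem (G := ofMap f leg) (S := {e}ᶜ)
          (e := f^[i] (f e)) (fun h => ?_) ?_)
        · have h' : f^[i] (f e) = e := h
          have h2 : f^[t - (i + 1)] (f e) = u := by
            rw [← htu]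
            conv_rhs => rw [show t = (t - (i + 1)) + (i + 1) by omega, Function.iterate_add_apply,
              Function.iterate_succ_apply', h']
          exact Nat.find_min hu (show t - (i + 1) < t by omega) h2
        · rw [Function.iterate_succ_apply']
          rfl
    rw [← htu]
    exact hind t le_rfl
  exact ⟨(key (Classical.arbitrary V)).mono (Set.subset_univ _), key⟩

/-- A fixed point of `f` has a loop, counted twice; any other vertex has an outgoing and a distinct
incoming edge. The leg supplies the third half-edge. -/
theorem ofMap_admissible (hf : ∀ x y, ∃ t, f^[t] x = y) (hleg : Function.Bijective leg) :
    (ofMap f leg).Admissible := by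
  refine ⟨ofMap_isOnePI hf, fun (v : V) => ?_⟩
  have h1 : Nat.card {i // leg i = v} = 1 := by
    obtain ⟨i, rfl⟩ := hleg.2 v
    refine Nat.card_eq_one_iff_unique.2 ⟨⟨fun a b => ?_⟩, ⟨i, rfl⟩⟩
    exact Subtype.ext (hleg.1 (a.2.trans b.2.symm))
  change 3 ≤ Nat.card {x : V // v ∈ s(x, f x)} + Nat.card {x : V // s(x, f x) = s(v, v)} +
    Nat.card {i // leg i = v}
  rw [h1]
  by_cases hv : f v = v
  · have h2 : 0 < Nat.card {x : V // v ∈ s(x, f x)} :=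
      Nat.card_pos_iff.2 ⟨⟨v, by simp⟩, inferInstance⟩
    have h3 : 0 < Nat.card {x : V // s(x, f x) = s(v, v)} :=
      Nat.card_pos_iff.2 ⟨⟨v, by rw [hv]⟩, inferInstance⟩
    omega
  · obtain ⟨w, hw⟩ : ∃ w, f w = v := by
      obtain ⟨t, ht⟩ := hf (f v) v
      cases t with
      | zero => exact absurd ht hv
      | succ t => exact ⟨_, (Function.iterate_succ_apply' f t _).symm.trans ht⟩
    have hwv : w ≠ v := fun h => hv (h ▸ hw)
    have h2 : 1 < Nat.card {x : V // v ∈ s(x, f x)} := by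
      rw [Finite.one_lt_card_iff_nontrivial]
      exact ⟨⟨w, by simp [hw]⟩, ⟨v, by simp⟩, fun h => hwv (congrArg Subtype.val h)⟩
    omega

/-- The graph with an edge from `x` to `f x` for each vertex `x`, with colours. -/
def _root_.HoloGraph.ofMap (f : V → V) (leg : Fin s → V) (col : V ≃ Fin s)
    (hf : ∀ x y, ∃ t, f^[t] x = y) (hleg : Function.Bijective leg) : HoloGraph 1 s where
  toLegGraph := LegGraph.ofMap f leg
  admissible := ofMap_admissible hf hleg
  rank_eq := by
    have h1 := (ofMap_isOnePI (leg := leg) hf).1.card_comp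
    have h2 : Nat.card (Set.univ : Set V) = Nat.card V := Nat.card_congr (Equiv.Set.univ _)
    unfold loopNumber
    rw [h1]
    change ((Nat.card (Set.univ : Set V) : ℕ) : ℤ) - Nat.card V + (1 : ℕ) = _
    rw [h2]
    ring
  color := col

end LegGraph

namespace LabelledCycle

variable {s k : ℕ}

/-- The cyclic successor on a cycle whose vertex `j` has been blown up to a path with `n j`
edges. -/
def blowUpSucc (n : ZMod k → ℕ) (x : Σ j : ZMod k, Fin (n j + 1)) : Σ j : ZMod k, Fin (n j + 1) :=
  Fin.lastCases (motive := fun _ => Σ j : ZMod k, Fin (n j + 1)) ⟨x.1 + 1, 0⟩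
    (fun i => ⟨x.1, i.succ⟩) x.2

theorem blowUpSucc_last (n : ZMod k → ℕ) (j : ZMod k) :
    blowUpSucc n ⟨j, Fin.last _⟩ = ⟨j + 1, 0⟩ := by
  simp [blowUpSucc]

theorem blowUpSucc_castSucc (n : ZMod k → ℕ) (j : ZMod k) (i : Fin (n j)) :
    blowUpSucc n ⟨j, i.castSucc⟩ = ⟨j, i.succ⟩ := by
  simp [blowUpSucc]

theorem exists_iterate_blowUpSucc [NeZero k] (n : ZMod k → ℕ) (x y : Σ j : ZMod k, Fin (n j + 1)) :
    ∃ t, (blowUpSucc n)^[t] x = y := by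
  have trans : ∀ {x y z}, (∃ t, (blowUpSucc n)^[t] x = y) → (∃ t, (blowUpSucc n)^[t] y = z) →
      ∃ t, (blowUpSucc n)^[t] x = z := by
    rintro x y z ⟨t, rfl⟩ ⟨t', rfl⟩
    exact ⟨t' + t, Function.iterate_add_apply _ _ _ _⟩
  have h1 : ∀ (j : ZMod k) (i : Fin (n j + 1)), ∃ t, (blowUpSucc n)^[t] ⟨j, 0⟩ = ⟨j, i⟩ := by
    intro j i
    induction i using Fin.induction with
    | zero => exact ⟨0, rfl⟩
    | succ i ih => exact trans ih ⟨1, blowUpSucc_castSucc n j i⟩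
  have h2 : ∀ (j : ZMod k) (i : Fin (n j + 1)), ∃ t, (blowUpSucc n)^[t] ⟨j, i⟩ = ⟨j + 1, 0⟩ := by
    intro j i
    induction i using Fin.reverseInduction with
    | last => exact ⟨1, blowUpSucc_last n j⟩
    | cast i ih => exact trans ⟨1, blowUpSucc_castSucc n j i⟩ ih
  have h3 : ∀ (j : ZMod k) (a : ℕ), ∃ t, (blowUpSucc n)^[t] ⟨j, 0⟩ = ⟨j + a, 0⟩ := by
    intro j a
    induction a with
    | zero =>
      rw [Nat.cast_zero, add_zero]
      exact ⟨0, rfl⟩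
    | succ a ih =>
      have := trans ih (h2 _ 0)
      rwa [add_assoc, ← Nat.cast_succ] at this
  obtain ⟨j, i⟩ := x
  obtain ⟨j', i'⟩ := y
  have h4 := h3 (j + 1) (j' - (j + 1)).val
  rw [ZMod.natCast_zmod_val, add_sub_cancel] at h4
  exact trans (h2 j i) (trans h4 (h1 j' i'))

/-- The edge leaving the last vertex of block `j` survives as the edge `j`; the other `n j` edges of
the block stay inside it and receive the colours remembered at `j`. -/
theorem exists_blowUp_coloring (x : LabelledCycle s k) {n : ZMod k → ℕ}
    (hn : ∀ j, n j = Nat.card {c // x.1.2 c = .inr j}) :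
    ∃ g : (Σ j : ZMod k, Fin (n j + 1)) ≃ Fin s,
      (∀ j, x.1.2 (g ⟨j, Fin.last _⟩) = .inl j) ∧
      ∀ j (i : Fin (n j)), x.1.2 (g ⟨j, i.castSucc⟩) = .inr j := by
  choose cl hcl hcl' using x.existsUnique_color
  have e : ∀ j, Fin (n j) ≃ {c // x.1.2 c = .inr j} := fun j =>
    (Finite.equivFinOfCardEq (hn j).symm).symm
  let g : (Σ j : ZMod k, Fin (n j + 1)) → Fin s := fun y =>
    Fin.lastCases (motive := fun _ => Fin s) (cl y.1) (fun i => (e y.1 i).1) y.2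
  have hg1 : ∀ j, g ⟨j, Fin.last _⟩ = cl j := fun j => by simp [g]
  have hg2 : ∀ j (i : Fin (n j)), g ⟨j, i.castSucc⟩ = (e j i).1 := fun j i => by simp [g]
  have hx1 : ∀ j, x.1.2 (g ⟨j, Fin.last _⟩) = .inl j := fun j => by rw [hg1, hcl]
  have hx2 : ∀ j (i : Fin (n j)), x.1.2 (g ⟨j, i.castSucc⟩) = .inr j := fun j i => by
    rw [hg2]; exact (e j i).2
  refine ⟨Equiv.ofBijective g ⟨?_, fun c => ?_⟩, hx1, hx2⟩
  · rintro ⟨j, i⟩ ⟨j', i'⟩ h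
    have h' := congrArg x.1.2 h
    induction i using Fin.lastCases with
    | last =>
      induction i' using Fin.lastCases with
      | last =>
        rw [hx1, hx1, Sum.inl.injEq] at h'
        rw [h']
      | cast i' =>
        rw [hx1, hx2] at h'
        cases h'
    | cast i =>
      induction i' using Fin.lastCases with
      | last =>
        rw [hx1, hx2] at h'
        cases h'
      | cast i' =>
        rw [hx2, hx2, Sum.inr.injEq] at h'
        subst h'
        rw [hg2, hg2] at h
        rw [(e j).injective (Subtype.ext h)]
  · cases hc : x.1.2 c with
    | inl j => exact ⟨⟨j, Fin.last _⟩, by rw [hg1]; exact (hcl' j c hc).symm⟩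
    | inr j => exact ⟨⟨j, ((e j).symm ⟨c, hc⟩).castSucc⟩, by rw [hg2, Equiv.apply_symm_apply]⟩

/-- Each labelled cycle comes from a graph. -/
theorem exists_holoGraph [NeZero k] (x : LabelledCycle s k) :
    ∃ (G : HoloGraph 1 s) (S : Set G.E), G.type S = x.type := by
  set n : ZMod k → ℕ := fun j => Nat.card {c // x.1.2 c = .inr j} with hn
  obtain ⟨g, hg1, hg2⟩ := x.exists_blowUp_coloring (n := n) fun _ => rfl
  -- The excess of one leg over remembered colours is exactly what gives each vertex of the block
  -- one leg.
  have e : ∀ j, {i // x.1.1 i = j} ≃ Fin (n j + 1) := fun j =>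
    Finite.equivFinOfCardEq (x.2 j).1
  let l : Fin s ≃ Σ j : ZMod k, Fin (n j + 1) :=
    (Equiv.sigmaFiberEquiv x.1.1).symm.trans (Equiv.sigmaCongrRight e)
  have hl : ∀ i, (l i).1 = x.1.1 i := fun i => rfl
  let G : HoloGraph 1 s := HoloGraph.ofMap (blowUpSucc n) l g (exists_iterate_blowUpSucc n) l.bijective
  let S : Set G.E := {y : Σ j : ZMod k, Fin (n j + 1) | (x.1.2 (g y)).isRight}
  have hS : ∀ j i, (⟨j, i⟩ : Σ j : ZMod k, Fin (n j + 1)) ∈ S ↔ i ≠ Fin.last _ := by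
    intro j i
    change (x.1.2 (g ⟨j, i⟩)).isRight = true ↔ _
    induction i using Fin.lastCases with
    | last => simp [hg1]
    | cast i => simp [hg2, Fin.castSucc_ne_last]
  have hsucc : ∀ y : (Σ j : ZMod k, Fin (n j + 1)), s(y.1, (blowUpSucc n y).1) =
      cycEnds (x.1.2 (g y)) := by
    rintro ⟨j, i⟩
    induction i using Fin.lastCases with
    | last => rw [blowUpSucc_last, hg1]; rfl
    | cast i => rw [blowUpSucc_castSucc, hg2]; rfl
  have hfst : ∀ y ∈ S, ∀ u v : (Σ j : ZMod k, Fin (n j + 1)), G.ends y = s(u, v) → u.1 = v.1 := by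
    intro y hy u v huv
    have h1 : s(y, blowUpSucc n y) = s(u, v) := huv
    have h2 : y.1 = (blowUpSucc n y).1 := by
      have h3 := hsucc y
      have hy' : (x.1.2 (g y)).isRight := hy
      cases h4 : x.1.2 (g y) with
      | inl j => simp [h4] at hy'
      | inr j =>
        rw [h4] at h3
        rcases Sym2.eq_iff.1 h3 with h | h <;> rw [h.1, h.2]
    rcases Sym2.eq_iff.1 h1 with ⟨rfl, rfl⟩ | ⟨rfl, rfl⟩
    · exact h2
    · exact h2.symm
  let h : G.Comp S → ZMod k := LegGraph.compLift (G := G.toLegGraph) S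
    (fun y : Σ j : ZMod k, Fin (n j + 1) => y.1) hfst
  -- Each block is connected through collapsed edges, so the block index is injective on components.
  have hzero : ∀ (j : ZMod k) (i : Fin (n j + 1)),
      G.comp S (⟨j, 0⟩ : Σ j : ZMod k, Fin (n j + 1)) = G.comp S (⟨j, i⟩ : Σ j : ZMod k, Fin (n j + 1)) := by
    intro j i
    induction i using Fin.induction with
    | zero => rfl
    | succ i ih =>
      refine ih.trans (LegGraph.comp_eq_of_mem (G := G.toLegGraph)
        ((hS j i.castSucc).2 (Fin.castSucc_ne_last i)) ?_)
      change s(_, blowUpSucc n ⟨j, i.castSucc⟩) = _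
      rw [blowUpSucc_castSucc]
      rfl
  refine ⟨G, S, typeInv_congr (h := h) ?_ ?_ (fun i => (hl i).symm) fun c => ?_⟩
  · intro a b hab
    obtain ⟨⟨j, i⟩, rfl⟩ := G.comp_surjective S a
    obtain ⟨⟨j', i'⟩, rfl⟩ := G.comp_surjective S b
    have : j = j' := hab
    subst this
    exact (hzero j i).symm.trans (hzero j i')
  · ext c
    change (x.1.2 (g (g.symm c))).isRight = true ↔ _
    rw [Equiv.apply_symm_apply]
    rfl
  · have := hsucc (g.symm c)
    rw [Equiv.apply_symm_apply] at this
    exact this.symm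

/-- The combinatorial type of a labelled cycle, as a cell. -/
noncomputable def cell {m : ℕ} (x : LabelledCycle s (m + 1)) : Cell s m :=
  ⟨x.type, x.exists_holoGraph, x.card_remaining⟩

end LabelledCycle

instance {s k : ℕ} [NeZero k] : Finite (LabelledCycle s k) :=
  inferInstanceAs (Finite (Subtype _))

instance {s m : ℕ} : Finite (Cell s m) := inferInstanceAs (Finite (Subtype _))

/-- Every fibre of `LabelledCycle.cell` is a free orbit of the automorphisms. -/
theorem card_cell_mul (s m : ℕ) :
    Nat.card (Cell s m) * Nat.card (CycleAut (m + 1)) = Nat.card (LabelledCycle s (m + 1)) := by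
  have := Fintype.ofFinite (Cell s m)
  rw [← Nat.card_congr (Equiv.sigmaFiberEquiv (LabelledCycle.cell (s := s) (m := m))), Nat.card_sigma,
    Nat.card_eq_fintype_card, ← smul_eq_mul, ← Finset.card_univ, ← Finset.sum_const]
  refine Finset.sum_congr rfl fun σ _ => ?_
  obtain ⟨x, hx⟩ := σ.exists_labelledCycle
  rw [← x.card_type_eq]
  refine Nat.card_congr (Equiv.subtypeEquivRight fun y => ?_)
  rw [hx]
  exact ⟨fun h => Subtype.ext h, fun h => congrArg Subtype.val h⟩


/-! ### Counting functions with given fibres -/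

section Rearrangements

variable {α ι : Type*} [Finite α]

theorem exists_comp_perm_eq_iff (f g : α → ι) :
    (∃ π : Equiv.Perm α, f ∘ π = g) ↔ ∀ i, Nat.card {a // g a = i} = Nat.card {a // f a = i} := by
  constructor
  · rintro ⟨π, rfl⟩ i
    exact Nat.card_congr (π.subtypeEquiv fun _ => Iff.rfl)
  · intro h
    have e : ∀ i, {a // g a = i} ≃ {a // f a = i} := fun i =>
      (Finite.equivFinOfCardEq (h i)).trans (Finite.equivFin _).symm
    exact ⟨Equiv.ofFiberEquiv e, funext fun a => Equiv.ofFiberEquiv_map e a⟩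

/-- Orbit-stabilizer for permutations acting by precomposition. -/
theorem card_rearrangements_mul (f : α → ι) :
    Nat.card {g : α → ι // ∃ π : Equiv.Perm α, f ∘ π = g} *
      Nat.card {π : Equiv.Perm α // f ∘ π = f} = (Nat.card α).factorial := by
  classical
  have := Fintype.ofFinite α
  let F : Equiv.Perm α → {g : α → ι // ∃ π : Equiv.Perm α, f ∘ π = g} := fun π => ⟨f ∘ π, π, rfl⟩
  have hF : Function.Surjective F := fun ⟨g, π, hπ⟩ => ⟨π, Subtype.ext hπ⟩
  have := Finite.of_surjective F hF
  have := Fintype.ofFinite {g : α → ι // ∃ π : Equiv.Perm α, f ∘ π = g}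
  rw [← Nat.card_perm, ← Nat.card_congr (Equiv.sigmaFiberEquiv F), Nat.card_sigma,
    Nat.card_eq_fintype_card, ← smul_eq_mul, ← Finset.card_univ, ← Finset.sum_const]
  refine Finset.sum_congr rfl fun g _ => ?_
  obtain ⟨π, rfl⟩ := hF g
  refine Nat.card_congr (Equiv.subtypeEquiv (Equiv.mulRight π) fun τ => ?_)
  rw [Subtype.ext_iff]
  change f ∘ τ = f ↔ f ∘ (τ * π) = f ∘ π
  rw [Equiv.Perm.coe_mul, ← Function.comp_assoc]
  exact π.surjective.injective_comp_right.eq_iff.symm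

/-- The number of functions with fibres of given cardinality is a multinomial coefficient. -/
theorem card_fiberCard_eq_mul [Fintype ι] (n : ι → ℕ) (hn : ∑ i, n i = Nat.card α) :
    Nat.card {f : α → ι // ∀ i, Nat.card {a // f a = i} = n i} * ∏ i, (n i).factorial =
      (Nat.card α).factorial := by
  classical
  have := Fintype.ofFinite α
  have e : α ≃ Σ i, Fin (n i) := Fintype.equivOfCardEq (by
    rw [← Nat.card_eq_fintype_card, ← hn]; simp)
  let f : α → ι := fun a => (e a).1
  have hf : ∀ i, Nat.card {a // f a = i} = n i := fun i => by
    rw [Nat.card_congr (e.subtypeEquiv (q := fun x => x.1 = i) fun _ => Iff.rfl),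
      ← Nat.card_congr (Equiv.ofBijective
        (fun a : Fin (n i) => (⟨⟨i, a⟩, rfl⟩ : {x : Σ i, Fin (n i) // x.1 = i}))
        ⟨fun a b h => by simpa using h, ?_⟩)]
    · simp
    · rintro ⟨⟨i, a⟩, rfl⟩
      exact ⟨a, rfl⟩
  have h := card_rearrangements_mul f
  simp only [exists_comp_perm_eq_iff, hf] at h
  rw [← h, Nat.card_eq_fintype_card (α := {π : Equiv.Perm α // f ∘ π = f}),
    DomMulAct.stabilizer_card]
  simp only [← Nat.card_eq_fintype_card, hf]

end Rearrangements

/-! ### Counting labelled cycles and cells. -/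

/-- All sequences `1 ≤ n_0, …, n_{k-1}` with sum `s`. -/
def positiveTuples (s : ℕ) (ι : Type) [Fintype ι] [DecidableEq ι] : Finset (ι → ℕ) :=
  (Fintype.piFinset fun _ => Finset.Icc 1 s).filter fun n => ∑ j, n j = s

theorem mem_positiveTuples {s : ℕ} {ι : Type} [Fintype ι] [DecidableEq ι] {n : ι → ℕ} :
    n ∈ positiveTuples s ι ↔ (∀ j, 1 ≤ n j) ∧ ∑ j, n j = s := by
  simp only [positiveTuples, Finset.mem_filter, Fintype.mem_piFinset, Finset.mem_Icc]
  refine ⟨fun h => ⟨fun j => (h.1 j).1, h.2⟩, fun h => ⟨fun j => ⟨h.1 j, ?_⟩, h.2⟩⟩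
  rw [← h.2]
  exact Finset.single_le_sum (fun _ _ => Nat.zero_le _) (Finset.mem_univ j)

namespace LabelledCycle

variable {s k : ℕ}

/-- The numbers of legs at the vertices. -/
noncomputable def legCount (x : LabelledCycle s k) (j : ZMod k) : ℕ := Nat.card {i // x.1.1 i = j}

theorem legCount_mem [NeZero k] (x : LabelledCycle s k) :
    x.legCount ∈ positiveTuples s (ZMod k) := by
  rw [mem_positiveTuples]
  refine ⟨fun j => by rw [legCount, (x.2 j).1]; omega, ?_⟩
  unfold legCount
  rw [← Nat.card_sigma, Nat.card_congr (Equiv.sigmaFiberEquiv x.1.1)]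
  simp

/-- For fixed `n`, legs and colours are placed independently: two multinomial counts, the second
with fibres of size `1` over edges and `n j - 1` over vertices. -/
theorem card_legCount_eq [NeZero k] {n : ZMod k → ℕ} (hn : n ∈ positiveTuples s (ZMod k)) :
    (Nat.card {x : LabelledCycle s k // x.legCount = n} : ℚ) =
      (s.factorial : ℚ) ^ 2 / ∏ j, (((n j).factorial : ℚ) * ((n j - 1).factorial : ℚ)) := by
  rw [mem_positiveTuples] at hn
  let n' : ZMod k ⊕ ZMod k → ℕ := Sum.elim (fun _ => 1) (fun j => n j - 1)
  have hn' : ∑ i, n' i = Nat.card (Fin s) := by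
    rw [Fintype.sum_sum_type, ← Finset.sum_add_distrib]
    simp only [n', Sum.elim_inl, Sum.elim_inr, Nat.card_eq_fintype_card, Fintype.card_fin]
    rw [← hn.2]
    exact Finset.sum_congr rfl fun j _ => by have := hn.1 j; omega
  have h1 := card_fiberCard_eq_mul (α := Fin s) n (by simpa using hn.2)
  have h2 := card_fiberCard_eq_mul (α := Fin s) n' hn'
  rw [Fintype.prod_sum_type] at h2
  simp only [n', Sum.elim_inl, Sum.elim_inr, Nat.factorial_one, Finset.prod_const_one,
    one_mul] at h2
  rw [Nat.card_fin] at h1 h2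
  let e : {x : LabelledCycle s k // x.legCount = n} ≃
      {L : Fin s → ZMod k // ∀ j, Nat.card {i // L i = j} = n j} ×
        {C : Fin s → ZMod k ⊕ ZMod k // ∀ j, Nat.card {c // C c = j} = n' j} :=
    { toFun := fun x => (⟨x.1.1.1, fun j => congrFun x.2 j⟩, ⟨x.1.1.2, by
        rintro (j | j)
        · exact (x.1.2 j).2
        · have h3 := (x.1.2 j).1
          have h4 := congrFun x.2 j
          unfold legCount at h4
          simp only [n', Sum.elim_inr]
          omega⟩)
      invFun := fun y => ⟨⟨(y.1.1, y.2.1), fun j => ⟨by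
        have h3 := y.2.2 (.inr j)
        have h4 := hn.1 j
        simp only [n', Sum.elim_inr] at h3
        rw [y.1.2 j, h3]
        omega, y.2.2 (.inl j)⟩⟩, funext y.1.2⟩
      left_inv := fun x => rfl
      right_inv := fun y => rfl }
  rw [Nat.card_congr e, Nat.card_prod, eq_div_iff, Finset.prod_mul_distrib]
  · have h3 := congrArg₂ (fun a b : ℕ => ((a * b : ℕ) : ℚ)) h1 h2
    push_cast at h3 ⊢
    rw [sq, ← h3]
    ring
  · exact Finset.prod_ne_zero_iff.2 fun j _ => by positivity

theorem card_eq_sum [NeZero k] :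
    (Nat.card (LabelledCycle s k) : ℚ) = ∑ n ∈ positiveTuples s (ZMod k),
      (s.factorial : ℚ) ^ 2 / ∏ j, (((n j).factorial : ℚ) * ((n j - 1).factorial : ℚ)) := by
  let f : LabelledCycle s k → positiveTuples s (ZMod k) := fun x => ⟨x.legCount, x.legCount_mem⟩
  rw [← Nat.card_congr (Equiv.sigmaFiberEquiv f), Nat.card_sigma, Nat.cast_sum,
    ← Finset.sum_coe_sort (positiveTuples s (ZMod k))]
  refine Finset.sum_congr rfl fun n _ => ?_
  rw [← card_legCount_eq n.2]
  exact congrArg Nat.cast (Nat.card_congr (Equiv.subtypeEquivRight fun x => Subtype.ext_iff))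

end LabelledCycle

/-- The sequences that sort to `i` are its rearrangements, and the stabilizer permutes equal
entries. -/
theorem card_sort_eq {k : ℕ} {i : Fin k → ℕ} (hi : Monotone i) :
    (Nat.card {n : Fin k → ℕ // n ∘ Tuple.sort n = i} : ℚ) = multiplicityFactor i := by
  classical
  have h1 : ∀ n : Fin k → ℕ, n ∘ Tuple.sort n = i ↔ ∃ π : Equiv.Perm (Fin k), i ∘ π = n := by
    intro n
    constructor
    · intro h
      refine ⟨(Tuple.sort n).symm, ?_⟩
      rw [← h, Function.comp_assoc, Equiv.self_comp_symm, Function.comp_id]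
    · rintro ⟨π, rfl⟩
      exact Tuple.unique_monotone (f := i) (σ := π * Tuple.sort (i ∘ π)) (τ := 1)
        (Tuple.monotone_sort (i ∘ π)) hi
  have h2 := card_rearrangements_mul i
  simp only [← h1] at h2
  rw [Nat.card_eq_fintype_card (α := {π : Equiv.Perm (Fin k) // i ∘ π = i}),
    DomMulAct.stabilizer_card', Nat.card_fin] at h2
  rw [multiplicityFactor, eq_div_iff, ← h2]
  · push_cast
    simp only [Fintype.card_subtype]
  · exact Finset.prod_ne_zero_iff.2 fun j _ => by positivity

/-- A sum of a symmetric function over all sequences as a sum over the sorted ones. -/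
theorem sum_positiveTuples_eq_sum_sortedTuples {s k : ℕ} (F : (Fin k → ℕ) → ℚ)
    (hF : ∀ (n : Fin k → ℕ) (π : Equiv.Perm (Fin k)), F (n ∘ π) = F n) :
    ∑ n ∈ positiveTuples s (Fin k), F n = ∑ i ∈ sortedTuples s k, multiplicityFactor i * F i := by
  classical
  have hmem : ∀ i : Fin k → ℕ, i ∈ sortedTuples s k ↔ i ∈ positiveTuples s (Fin k) ∧ Monotone i := by
    intro i
    simp only [sortedTuples, positiveTuples, Finset.mem_filter]
    tauto
  have hperm : ∀ (n : Fin k → ℕ) (π : Equiv.Perm (Fin k)),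
      n ∘ π ∈ positiveTuples s (Fin k) ↔ n ∈ positiveTuples s (Fin k) := by
    intro n π
    rw [mem_positiveTuples, mem_positiveTuples]
    simp only [Function.comp_apply, Equiv.sum_comp]
    exact and_congr_left' (π.forall_congr_right (q := fun j => 1 ≤ n j))
  rw [← Finset.sum_fiberwise_of_maps_to (t := sortedTuples s k)
    (g := fun n : Fin k → ℕ => n ∘ Tuple.sort n)
    fun n hn => (hmem _).2 ⟨(hperm _ _).2 hn, Tuple.monotone_sort n⟩]
  refine Finset.sum_congr rfl fun i hi => ?_
  rw [hmem] at hi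
  rw [Finset.sum_congr rfl (g := fun _ => F i) fun n hn => by
    rw [← (Finset.mem_filter.1 hn).2, hF], Finset.sum_const, nsmul_eq_mul, ← card_sort_eq hi.2,
    ← Nat.card_eq_finsetCard]
  congr 2
  refine Nat.card_congr (Equiv.subtypeEquivRight fun n => ?_)
  rw [Finset.mem_filter, and_iff_right_iff_imp]
  rintro rfl
  exact (hperm _ _).1 hi.1

/-- The factor `1 + δ` compensates for the missing flip at `k = 1`, giving one formula for all `k =
m + 1`. -/
theorem card_cycleAut (m : ℕ) :
    (Nat.card (CycleAut (m + 1)) : ℚ) * (1 + if m + 1 = 1 then 1 else 0) = 2 * ((m + 1 : ℕ) : ℚ) := by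
  cases m with
  | zero =>
    rw [CycleAut.card_one]
    norm_num
  | succ m =>
    rw [CycleAut.card_of_two_le (by omega), if_neg (by omega)]
    push_cast
    ring

/-- The number of combinatorial types with `m + 1` remaining edges. -/
theorem card_cell (s m : ℕ) :
    (Nat.card (Cell s m) : ℚ) = (s.factorial : ℚ) ^ 2 *
      (((1 + if m + 1 = 1 then 1 else 0) / (2 * ((m + 1 : ℕ) : ℚ))) *
        ∑ i ∈ sortedTuples s (m + 1), multiplicityFactor i /
          ∏ n : Fin (m + 1), (((i n).factorial : ℚ) * ((i n - 1).factorial : ℚ))) := by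
  have h1 := congrArg (Nat.cast (R := ℚ)) (card_cell_mul s m)
  rw [Nat.cast_mul, LabelledCycle.card_eq_sum] at h1
  have h2 := sum_positiveTuples_eq_sum_sortedTuples (s := s) (k := m + 1)
    (fun n => (s.factorial : ℚ) ^ 2 / ∏ j, (((n j).factorial : ℚ) * ((n j - 1).factorial : ℚ)))
    fun n π => by
      simp only [Function.comp_apply]
      rw [Equiv.prod_comp π fun j => (((n j).factorial : ℚ) * ((n j - 1).factorial : ℚ))]
  have h3 := h1.trans h2
  have h4 := card_cycleAut m
  set δ : ℚ := 1 + if m + 1 = 1 then 1 else 0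
  have hk : (2 * ((m + 1 : ℕ) : ℚ)) ≠ 0 := by positivity
  have hA : (Nat.card (CycleAut (m + 1)) : ℚ) ≠ 0 := fun h => hk (by rw [← h4, h, zero_mul])
  have h5 : δ / (2 * ((m + 1 : ℕ) : ℚ)) = (Nat.card (CycleAut (m + 1)) : ℚ)⁻¹ := by
    rw [← h4]
    have : δ ≠ 0 := fun h => hk (by rw [← h4, h, mul_zero])
    field_simp
  rw [h5, mul_left_comm, Finset.mul_sum, eq_inv_mul_iff_mul_eq₀ hA, mul_comm, h3]
  exact Finset.sum_congr rfl fun i _ => by ring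

theorem Cell.isEmpty {s m : ℕ} (h : s ≤ m) : IsEmpty (Cell s m) :=
  ⟨fun σ => by
    have := σ.2.2
    have h2 := Finset.card_le_univ σ.1.remaining
    rw [Fintype.card_fin] at h2
    omega⟩

theorem mainTheorem11 (s : ℕ) :
    (∃ D : DeltaComplex (MRG 1 s), D.IsGraphDecomposition) ∧
    ∀ D : DeltaComplex (MRG 1 s), D.IsGraphDecomposition →
      D.IsFinite ∧
      (D.eulerChar : ℚ) =
        (s.factorial : ℚ) ^ 2 *
          ∑ k ∈ Finset.Icc 1 s,
            ((-1 : ℚ) ^ (k - 1) * (1 + if k = 1 then 1 else 0) / (2 * k)) *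
              ∑ i ∈ sortedTuples s k,
                multiplicityFactor i /
                  ∏ n : Fin k, (((i n).factorial : ℚ) * ((i n - 1).factorial : ℚ)) := by
  refine ⟨⟨_, MRG.isGraphDecomposition_deltaComplex s⟩, fun D hD => ?_⟩
  have e : ∀ m, D.simplex m ≃ Cell s m := fun m => Classical.choice (hD.nonempty_equiv m)
  have hfin : ∀ m, Finite (D.simplex m) := fun m => Finite.of_equiv _ (e m).symm
  have hempty : ∀ m, s ≤ m → IsEmpty (D.simplex m) := fun m hm =>
    (e m).isEmpty_congr.2 (Cell.isEmpty hm)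
  constructor
  · refine Finite.of_surjective
      (fun x : Σ m : Fin s, D.simplex m => (⟨x.1, x.2⟩ : Σ m, D.simplex m)) ?_
    rintro ⟨m, σ⟩
    have hm : m < s := by
      by_contra h
      exact (hempty m (not_lt.1 h)).false σ
    exact ⟨⟨⟨m, hm⟩, σ⟩, rfl⟩
  -- Graphs with `k` remaining edges are simplices of dimension `k - 1`, hence the index shift.
  · rw [D.eulerChar_eq_sum hempty, Finset.mul_sum, ← Finset.Ico_add_one_right_eq_Icc,
      Finset.sum_Ico_eq_sum_range, Int.cast_sum]
    refine Finset.sum_congr rfl fun m _ => ?_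
    rw [Nat.card_congr (e m), add_comm 1 m, Nat.add_sub_cancel]
    push_cast
    rw [card_cell]
    push_cast
    ring
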